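/- A partial field is a pair $\mathbb{P}=(R,G)$, where $R$ is a commutative ring with unity and $G$ is a subgroup of the group of units of $R$ with $-1\in G$; one writes $p\in\mathbb{P}$ for $p\in G\cup\{0\}$. A field $\mathbb{F}$ is identified with the partial field $(\mathbb{F},\mathbb{F}^*)$. The set of fundamentals of $\mathbb{P}$ is $\mathfrak{F}(\mathbb{P})=\{p\in\mathbb{P} : 1-p\in\mathbb{P}\}$. A homomorphism $\phi:\mathbb{P}_1\to\mathbb{P}_2$ of partial fields is a function with $\phi(1)=1$, $\phi(pq)=\phi(p)\phi(q)$ for all $p,q\in\mathbb{P}_1$, and $\phi(p)+\phi(q)=\phi(p+q)$ for all $p,q\in\mathbb{P}_1$ with $p+q\in\mathbb{P}_1$; for a matrix, $\phi([a_{ij}])=[\phi(a_{ij})]$. A $\mathbb{P}$-matrix is a finite matrix all of whose subdeterminants (in particular, all of whose entries) lie in $\mathbb{P}$. Two matrices over $\mathbb{P}$ are scaling-equivalent if one is obtained from the other by multiplying rows and columns by elements of $G$. For a $\mathbb{P}$-matrix $A$, write $B\preceq A$ if $B$ can be obtained from $A$ by a finite sequence of the following operations: multiplying a row or column by an element of $G$,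 deleting a row or column, permuting rows or columns, and pivoting on a non-zero entry. (Pivoting on the entry $a_{xy}$ replaces $a_{xy}$ by $a_{xy}^{-1}$, the other entries $a_{xv}$ of row $x$ by $a_{xy}^{-1}a_{xv}$, the other entries $a_{uy}$ of column $y$ by $-a_{uy}a_{xy}^{-1}$, and every remaining entry $a_{uv}$ by $a_{uv}-a_{uy}a_{xy}^{-1}a_{xv}$.) The set of cross ratios of $A$ is $$\mathrm{Cr}(A)=\left\{p : \begin{bmatrix}1&1\\p&1\end{bmatrix}\preceq A\right\},$$ and $A$ is $F$-confined, for a set $F$ of fundamentals, if $\mathrm{Cr}(A)\subseteq F\cup\{0,1\}$. **Corollary.** Let $\mathbb{P}$ be a partial field, let $\mathbb{F}$ be a finite field, let $\phi:\mathbb{P}\to\mathbb{F}$ be a partial-field homomorphism, let $F=\phi(\mathfrak{F}(\mathbb{P}))$, and let $A$ be an $F$-confined $\mathbb{F}$-matrix. Suppose that the restriction of $\phi$ to $\mathfrak{F}(\mathbb{P})$ is injective, and that 1. for all $p,q\in\mathfrak{F}(\mathbb{P})$, if $\phi(p)+\phi(q)=1$, then $p+q=1$; 2. for all $p,q,r\in\mathfrak{F}(\mathbb{P})$,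 if $\phi(p)\phi(q)\phi(r)=1$, then $pqr=1$; and 3. if $1=-1$ in $\mathbb{F}$, then $1=-1$ in $\mathbb{P}$. Then there exists a $\mathbb{P}$-matrix $A'$ such that $\phi(A')$ is scaling-equivalent to $A$. -/

import Mathlib

universe u v w

/-- A partial field `(R, G)` over the commutative ring `R`: a subgroup `G` of the group of units
of `R` with `-1 ∈ G`. -/
structure PartialField (R : Type w) [CommRing R] where
  /-- The group of the partial field. -/
  G : Subgroup Rˣ
  neg_one_mem : (-1 : Rˣ) ∈ G

namespace PartialField

/-- The partial field `(𝔽, 𝔽ˣ)` of a field `𝔽`. -/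
def ofField (𝔽 : Type w) [Field 𝔽] : PartialField 𝔽 where
  G := ⊤
  neg_one_mem := Subgroup.mem_top _

section Basic

variable {R : Type w} [CommRing R] (P : PartialField R)

/-- The elements `G ∪ {0}` of a partial field `(R, G)`, as a multiplicative submonoid of `R`. -/
def elems : Submonoid R where
  carrier := {p | p = 0 ∨ ∃ g ∈ P.G, (g : R) = p}
  one_mem' := Or.inr ⟨1, P.G.one_mem, rfl⟩
  mul_mem' := by
    rintro a b (rfl | ⟨g, hg, rfl⟩) (rfl | ⟨k, hk, rfl⟩)
    · exact Or.inl (mul_zero 0)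
    · exact Or.inl (zero_mul _)
    · exact Or.inl (mul_zero _)
    · exact Or.inr ⟨g * k, P.G.mul_mem hg hk, Units.val_mul g k⟩

/-- The fundamental elements: those `p ∈ G ∪ {0}` with `1 - p ∈ G ∪ {0}`. -/
def fundamentals : Set P.elems := {p | 1 - (p : R) ∈ P.elems}

/-- `A` is a `P`-matrix: every subdeterminant of `A` (in particular, every entry) lies in
`G ∪ {0}`. The order in which rows and columns are listed only affects the sign. -/
def IsPMatrix {X : Type u} {Y : Type v} (A : Matrix X Y R) : Prop :=
  ∀ (n : ℕ) (r : Fin n ↪ X) (c : Fin n ↪ Y), (A.submatrix r c).det ∈ P.elems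

end Basic

section Operations

variable {R : Type w} [CommRing R] {X : Type u} {Y : Type v}

open scoped Classical in
/-- Multiply row `x` of `A` by `a`. -/
noncomputable def scaleRow (A : Matrix X Y R) (x : X) (a : R) : Matrix X Y R :=
  fun i j => if i = x then a * A i j else A i j

open scoped Classical in
/-- Multiply column `y` of `A` by `a`. -/
noncomputable def scaleCol (A : Matrix X Y R) (y : Y) (a : R) : Matrix X Y R :=
  fun i j => if j = y then a * A i j else A i j

open scoped Classical in
/-- The matrix obtained from `A` by pivoting on the (invertible) entry in position `(x, y)`.
In terms of labels the pivot exchanges the label `x` of a row with the label `y` of a column;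
here rows and columns keep their positions. -/
noncomputable def pivot (A : Matrix X Y R) (x : X) (y : Y) : Matrix X Y R :=
  fun i j =>
    if i = x then
      if j = y then Ring.inverse (A x y) else Ring.inverse (A x y) * A x j
    else
      if j = y then -(A i y * Ring.inverse (A x y))
      else A i j - A i y * Ring.inverse (A x y) * A x j

end Operations

section Minors

variable {R : Type w} [CommRing R] (P : PartialField R)

/-- `P.Yields A B` says that `B ≼ A`: the matrix `B` is obtained from `A` by a finite sequence of
the following operations: multiplying a row or a column by an element of `G`, deleting a row or a
column, permuting (and relabelling) rows and columns, and pivoting on a non-zero entry. -/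
inductive Yields {X : Type u} {Y : Type v} (A : Matrix X Y R) :
    ∀ {X' : Type u} {Y' : Type v}, Matrix X' Y' R → Prop
  | refl : Yields A A
  | scaleRow {X' : Type u} {Y' : Type v} {B : Matrix X' Y' R} (h : Yields A B)
      (x : X') (g : Rˣ) (hg : g ∈ P.G) : Yields A (scaleRow B x (g : R))
  | scaleCol {X' : Type u} {Y' : Type v} {B : Matrix X' Y' R} (h : Yields A B)
      (y : Y') (g : Rˣ) (hg : g ∈ P.G) : Yields A (scaleCol B y (g : R))
  | deleteRow {X' : Type u} {Y' : Type v} {B : Matrix X' Y' R} (h : Yields A B)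
      (x : X') : Yields A (B.submatrix (Subtype.val : {i : X' // i ≠ x} → X') id)
  | deleteCol {X' : Type u} {Y' : Type v} {B : Matrix X' Y' R} (h : Yields A B)
      (y : Y') : Yields A (B.submatrix id (Subtype.val : {j : Y' // j ≠ y} → Y'))
  | permute {X' X'' : Type u} {Y' Y'' : Type v} {B : Matrix X' Y' R} (h : Yields A B)
      (e : X'' ≃ X') (f : Y'' ≃ Y') : Yields A (B.submatrix e f)
  | pivot {X' : Type u} {Y' : Type v} {B : Matrix X' Y' R} (h : Yields A B)
      (x : X') (y : Y') (hxy : B x y ≠ 0) : Yields A (pivot B x y)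

/-- The cross ratios of `A`: all `p` such that `[[1, 1], [p, 1]] ≼ A`. -/
def crossRatios {X : Type u} {Y : Type v} (A : Matrix X Y R) : Set R :=
  {p | ∃ (X' : Type u) (Y' : Type v) (B : Matrix X' Y' R) (e : Fin 2 ≃ X') (f : Fin 2 ≃ Y'),
    P.Yields A B ∧ B.submatrix e f = !![1, 1; p, 1]}

/-- `A` is an `F`-confined `P`-matrix. -/
def IsConfined {X : Type u} {Y : Type v} (F : Set R) (A : Matrix X Y R) : Prop :=
  P.IsPMatrix A ∧ P.crossRatios A ⊆ F ∪ {0, 1}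

/-- `B` is obtained from `A` by scaling rows and columns by elements of `G`. -/
def ScalingEquivalent {X : Type u} {Y : Type v} (A B : Matrix X Y R) : Prop :=
  ∃ (r : X → P.G) (c : Y → P.G), ∀ i j,
    B i j = ((r i : Rˣ) : R) * A i j * ((c j : Rˣ) : R)

end Minors

/-- A homomorphism of partial fields: a map `φ : P → Q` with `φ 1 = 1`, `φ (p q) = φ p φ q`, and
`φ p + φ q = φ (p + q)` whenever `p + q` lies in `P`. -/
structure Hom {R : Type u} [CommRing R] {S : Type v} [CommRing S]
    (P : PartialField R) (Q : PartialField S) extends P.elems →* Q.elems where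
  map_add' : ∀ (p q : P.elems) (h : (p : R) + (q : R) ∈ P.elems),
    ((toFun p : Q.elems) : S) + (toFun q : S) = (toFun ⟨(p : R) + (q : R), h⟩ : S)

/-- The value of a homomorphism at an element of `P`, as an element of the ring of `Q`. -/
def Hom.val {R : Type u} [CommRing R] {S : Type v} [CommRing S]
    {P : PartialField R} {Q : PartialField S} (φ : Hom P Q) (p : P.elems) : S :=
  (φ.toMonoidHom p : S)

end PartialField

/-! If `s - t` is a 2 × 2 subdeterminant of a `P`-matrix, with `s` and `t` products of entries and
`s ≠ 0`, then `t / s` is a fundamental. Since `φ` is injective on fundamentals, the cross ratios of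
a lift can be read off from its image, and lifts are unique up to scaling
(`IsLiftable.exists_scaling`).

Existence is an induction on the number of nonzero rows and columns (`CrossConfined.hasLift`).
Deleting a column is modelled by setting it to zero, so that the index types never change. Suppose
some column has three nonzero entries. A spanning tree of its component in the bipartite support
graph then has three leaves, two of them on the same side, say columns `x` and `y`; removing both
keeps the rest of the component connected (`exists_columnsLinked`). By uniqueness the lifts without
`x` and without `y` can be scaled to agree elsewhere, and they glue to a matrix `M`
(`HasLift.glue`); connectedness makes the image of `M` a scaling of `A`.

Only the subdeterminants of `M` using both `x` and `y` are in doubt. Pivoting elsewhere reduces them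
to 2 × 2 determinants in these columns (`isPMatrix_of_two_columns`), and reduces the distance
between the two rows to at most two (`IsChain.exists_le_two`). There the cross ratio factors into
two known fundamentals; its image lies in `F` by confinement, so the hypothesis on triple products
makes it a fundamental (`IsLiftable.sub_mem_trans`). One configuration resists this, and in it the
cross ratio is `-1`: the hypotheses on sums and on `1 = -1` then give `2 ∈ P`
(`IsLiftable.two_mem`).

If no row or column has three nonzero entries, then either some nonzero line has a single nonzero
entry, or a pivot creates a column with three, or there is a 2 × 2 block that splits off and is
lifted by choosing a fundamental over its cross ratio (`Critical.hasLift`). -/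

namespace PartialField

/-! ### Arithmetic in `G ∪ {0}`. -/

section Elems

variable {R : Type w} [CommRing R] {P : PartialField R}

theorem zero_mem_elems : (0 : R) ∈ P.elems := Or.inl rfl

theorem neg_mem_elems {p : R} (hp : p ∈ P.elems) : -p ∈ P.elems := by
  rcases hp with rfl | ⟨g, hg, rfl⟩
  · exact Or.inl neg_zero
  · exact Or.inr ⟨-1 * g, P.G.mul_mem P.neg_one_mem hg, by simp⟩

theorem neg_mem_elems_iff {p : R} : -p ∈ P.elems ↔ p ∈ P.elems :=
  ⟨fun h => by simpa using neg_mem_elems h, neg_mem_elems⟩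

theorem sub_mem_elems_comm {p q : R} : p - q ∈ P.elems ↔ q - p ∈ P.elems := by
  rw [← neg_mem_elems_iff, neg_sub]

theorem isUnit_of_mem_elems {p : R} (hp : p ∈ P.elems) (h0 : p ≠ 0) : IsUnit p := by
  rcases hp with rfl | ⟨g, hg, rfl⟩
  · exact absurd rfl h0
  · exact g.isUnit

theorem inverse_mem_elems {p : R} (hp : p ∈ P.elems) : Ring.inverse p ∈ P.elems := by
  rcases hp with rfl | ⟨g, hg, rfl⟩
  · rw [Ring.inverse_zero]; exact zero_mem_elems
  · rw [Ring.inverse_unit]; exact Or.inr ⟨g⁻¹, P.G.inv_mem hg, rfl⟩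

theorem mul_mem_elems_iff {p q : R} (hp : p ∈ P.elems) (h0 : p ≠ 0) :
    p * q ∈ P.elems ↔ q ∈ P.elems := by
  refine ⟨fun h => ?_, fun h => P.elems.mul_mem hp h⟩
  have := P.elems.mul_mem (inverse_mem_elems hp) h
  rwa [Ring.inverse_mul_cancel_left _ _ (isUnit_of_mem_elems hp h0)] at this

theorem neg_one_pow_mem_elems (n : ℕ) : (-1 : R) ^ n ∈ P.elems :=
  P.elems.pow_mem (neg_mem_elems P.elems.one_mem) n

theorem neg_one_pow_mul_mem_elems {p : R} (n : ℕ) (hp : p ∈ P.elems) :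
    (-1 : R) ^ n * p ∈ P.elems :=
  P.elems.mul_mem (neg_one_pow_mem_elems n) hp

end Elems

/-! ### Closure properties of `P`-matrices. -/

section PMatrix

variable {R : Type w} [CommRing R] {P : PartialField R} {X : Type u} {Y : Type v}

theorem IsPMatrix.det_mem {A : Matrix X Y R} (hA : P.IsPMatrix A) {n : ℕ} (r : Fin n → X)
    (c : Fin n → Y) : (A.submatrix r c).det ∈ P.elems := by
  by_cases hr : Function.Injective r
  · by_cases hc : Function.Injective c
    · exact hA n ⟨r, hr⟩ ⟨c, hc⟩
    · simp only [Function.Injective, not_forall] at hc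
      obtain ⟨i, j, hij, hne⟩ := hc
      rw [Matrix.det_zero_of_column_eq hne (fun k => by simp [hij])]
      exact zero_mem_elems
  · simp only [Function.Injective, not_forall] at hr
    obtain ⟨i, j, hij, hne⟩ := hr
    rw [Matrix.det_zero_of_row_eq hne (by ext k; simp [hij])]
    exact zero_mem_elems

theorem IsPMatrix.apply_mem {A : Matrix X Y R} (hA : P.IsPMatrix A) (i : X) (j : Y) :
    A i j ∈ P.elems := by
  simpa using hA.det_mem (fun _ : Fin 1 => i) (fun _ => j)

theorem IsPMatrix.two_mem {A : Matrix X Y R} (hA : P.IsPMatrix A) (i k : X) (j l : Y) :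
    A i j * A k l - A i l * A k j ∈ P.elems := by
  simpa [-Matrix.submatrix_cons_row, Matrix.det_fin_two] using hA.det_mem ![i, k] ![j, l]

theorem IsPMatrix.submatrix {A : Matrix X Y R} (hA : P.IsPMatrix A) {X' Y' : Type*} (r : X' → X)
    (c : Y' → Y) : P.IsPMatrix (A.submatrix r c) := fun n r' c' => by
  rw [Matrix.submatrix_submatrix]; exact hA.det_mem _ _

theorem IsPMatrix.transpose {A : Matrix X Y R} (hA : P.IsPMatrix A) : P.IsPMatrix A.transpose :=
  fun n r c => by
    rw [← Matrix.det_transpose, Matrix.transpose_submatrix, Matrix.transpose_transpose]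
    exact hA.det_mem _ _

theorem IsPMatrix.scale {A : Matrix X Y R} (hA : P.IsPMatrix A) {r : X → R} {c : Y → R}
    (hr : ∀ i, r i ∈ P.elems) (hc : ∀ j, c j ∈ P.elems) :
    P.IsPMatrix (Matrix.of fun i j => r i * A i j * c j) := fun n r' c' => by
  have : (Matrix.of fun i j => r i * A i j * c j).submatrix r' c' =
      Matrix.diagonal (fun k => r (r' k)) * A.submatrix r' c' *
        Matrix.diagonal (fun k => c (c' k)) := by
    ext i j; simp [Matrix.diagonal_mul, Matrix.mul_diagonal]
  rw [this, Matrix.det_mul, Matrix.det_mul, Matrix.det_diagonal, Matrix.det_diagonal]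
  exact P.elems.mul_mem (P.elems.mul_mem (P.elems.prod_mem fun _ _ => hr _) (hA.det_mem _ _))
    (P.elems.prod_mem fun _ _ => hc _)

variable [DecidableEq Y]

theorem IsPMatrix.updateCol_zero {A : Matrix X Y R} (hA : P.IsPMatrix A) (y : Y) :
    P.IsPMatrix (A.updateCol y 0) := by
  have := hA.scale (r := fun _ => 1) (c := fun j => if j = y then 0 else 1)
    (fun _ => P.elems.one_mem) (fun j => by
      split_ifs
      exacts [zero_mem_elems, P.elems.one_mem])
  convert this using 1
  ext i j
  simp [Matrix.updateCol_apply]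

theorem det_submatrix_mem_of_updateCol {A : Matrix X Y R} {y : Y}
    (hA : P.IsPMatrix (A.updateCol y 0)) {n : ℕ} (r : Fin n → X) (c : Fin n → Y)
    (hc : ∀ k, c k ≠ y) : (A.submatrix r c).det ∈ P.elems := by
  have : A.submatrix r c = (A.updateCol y 0).submatrix r c := by
    ext i j; simp [hc]
  rw [this]
  exact hA.det_mem _ _

/-- Adding a column with at most one nonzero entry preserves `P`-matrices. -/
theorem isPMatrix_of_updateCol_of_col {A : Matrix X Y R} {y : Y} {x : X}
    (hA : P.IsPMatrix (A.updateCol y 0)) (hx : A x y ∈ P.elems) (h0 : ∀ i, i ≠ x → A i y = 0) :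
    P.IsPMatrix A := by
  intro n r c
  by_cases hc : ∃ k, c k = y
  · obtain ⟨k, hk⟩ := hc
    obtain _ | n := n
    · exact k.elim0
    rw [Matrix.det_succ_column _ k]
    by_cases hr : ∃ l, r l = x
    · obtain ⟨l, hl⟩ := hr
      rw [Finset.sum_eq_single l]
      · refine P.elems.mul_mem (neg_one_pow_mul_mem_elems _ (by simpa [hk, hl] using hx)) ?_
        rw [Matrix.submatrix_submatrix]
        refine det_submatrix_mem_of_updateCol hA _ _ fun m hm => ?_
        rw [← hk] at hm
        exact Fin.succAbove_ne _ _ (c.injective hm)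
      · intro i _ hi
        have : A (r i) y = 0 := h0 _ fun h => hi (r.injective (h.trans hl.symm))
        simp [hk, this]
      · simp
    · push Not at hr
      rw [Finset.sum_eq_zero]
      · exact zero_mem_elems
      · intro i _
        simp [hk, h0 _ (hr i)]
  · push Not at hc
    exact det_submatrix_mem_of_updateCol hA _ _ hc

end PMatrix

/-! ### Pivoting and subdeterminants. -/

section Schur

variable {R : Type w} [CommRing R] {P : PartialField R} {X : Type u} {Y : Type v}

theorem pivot_apply_self (A : Matrix X Y R) (x : X) (y : Y) :
    pivot A x y x y = Ring.inverse (A x y) := by simp [pivot]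

theorem pivot_apply_row (A : Matrix X Y R) (x : X) {y j : Y} (hj : j ≠ y) :
    pivot A x y x j = Ring.inverse (A x y) * A x j := by simp [pivot, hj]

theorem pivot_apply_col (A : Matrix X Y R) {x i : X} (hi : i ≠ x) (y : Y) :
    pivot A x y i y = -(A i y * Ring.inverse (A x y)) := by simp [pivot, hi]

theorem pivot_apply (A : Matrix X Y R) {x i : X} (hi : i ≠ x) {y j : Y} (hj : j ≠ y) :
    pivot A x y i j = A i j - A i y * Ring.inverse (A x y) * A x j := by simp [pivot, hi, hj]

/-- The Schur complement formula for a pivot. -/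
theorem det_submatrix_eq_pivot {A : Matrix X Y R} {n : ℕ} {r : Fin (n + 1) → X}
    {c : Fin (n + 1) → Y} (hr : Function.Injective r) (hc : Function.Injective c)
    (k l : Fin (n + 1)) (ha : IsUnit (A (r k) (c l))) :
    (A.submatrix r c).det = (-1) ^ (k + l : ℕ) * A (r k) (c l) *
      ((pivot A (r k) (c l)).submatrix (r ∘ k.succAbove) (c ∘ l.succAbove)).det := by
  set a := A (r k) (c l) with ha'
  -- Row operations clear column `l` outside row `k`; the remaining minor is the Schur complement.
  let B : Matrix (Fin (n + 1)) (Fin (n + 1)) R := Matrix.of fun i j =>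
    A (r i) (c j) + (if i = k then 0 else -(A (r i) (c l) * Ring.inverse a)) * A (r k) (c j)
  have hB : B.det = (A.submatrix r c).det :=
    Matrix.det_eq_of_forall_row_eq_smul_add_const
      (fun i => if i = k then 0 else -(A (r i) (c l) * Ring.inverse a)) k (by simp)
      (fun i j => by simp [B])
  rw [← hB, Matrix.det_succ_column _ l, Finset.sum_eq_single k]
  · have h1 : B k l = a := by simp [B, ha']
    have h2 : B.submatrix k.succAbove l.succAbove =
        (pivot A (r k) (c l)).submatrix (r ∘ k.succAbove) (c ∘ l.succAbove) := by
      ext i j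
      simp only [Matrix.submatrix_apply, Function.comp_apply, B, Matrix.of_apply]
      rw [pivot_apply _ (fun h => Fin.succAbove_ne _ _ (hr h))
        (fun h => Fin.succAbove_ne _ _ (hc h)), if_neg (Fin.succAbove_ne _ _), ← ha']
      ring
    rw [h1, h2]
  · intro i _ hi
    have : B i l = 0 := by
      simp only [B, Matrix.of_apply, if_neg hi, ← ha']
      rw [neg_mul, mul_assoc, Ring.inverse_mul_cancel _ ha]
      ring
    simp [this]
  · simp

/-- Up to an invertible factor, each subdeterminant of the pivoted matrix is one of `A`. If it uses
both pivot lines, pivoting back leaves a smaller minor. If it uses one of them, row or column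
operations give the minor of `A` in the same position. If it uses neither, it is a Schur complement
of the minor enlarged by `x` and `y`. -/
theorem isPMatrix_pivot {A : Matrix X Y R} (hA : P.IsPMatrix A) {x : X} {y : Y}
    (h0 : A x y ≠ 0) : P.IsPMatrix (pivot A x y) := by
  intro n r c
  have ha := hA.apply_mem x y
  have hu := isUnit_of_mem_elems ha h0
  by_cases hx : ∃ k, r k = x
  · obtain ⟨k, rfl⟩ := hx
    by_cases hy : ∃ l, c l = y
    · obtain ⟨l, rfl⟩ := hy
      obtain _ | n := n
      · exact k.elim0
      have hu' : IsUnit (pivot A (r k) (c l) (r k) (c l)) := by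
        rw [pivot_apply_self]; exact hu.ringInverse
      rw [det_submatrix_eq_pivot r.injective c.injective k l hu', pivot_apply_self, mul_assoc]
      refine neg_one_pow_mul_mem_elems _ (P.elems.mul_mem (inverse_mem_elems ha) ?_)
      have : (pivot (pivot A (r k) (c l)) (r k) (c l)).submatrix (r ∘ k.succAbove)
          (c ∘ l.succAbove) = A.submatrix (r ∘ k.succAbove) (c ∘ l.succAbove) := by
        ext i j
        have hi : r (k.succAbove i) ≠ r k := fun h => Fin.succAbove_ne _ _ (r.injective h)
        have hj : c (l.succAbove j) ≠ c l := fun h => Fin.succAbove_ne _ _ (c.injective h)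
        simp only [Matrix.submatrix_apply, Function.comp_apply]
        rw [pivot_apply _ hi hj, pivot_apply _ hi hj, pivot_apply_col _ hi, pivot_apply_row _ _ hj,
          pivot_apply_self]
        have e := Ring.inverse_mul_cancel _ hu'
        rw [pivot_apply_self] at e
        linear_combination (A (r (k.succAbove i)) (c l) * Ring.inverse (A (r k) (c l)) *
          A (r k) (c (l.succAbove j))) * e
      rw [this]
      exact hA.det_mem _ _
    · push Not at hy
      let B := (A.submatrix r c).updateRow k (Ring.inverse (A (r k) y) • (A.submatrix r c).row k)
      have hB : ((pivot A (r k) y).submatrix r c).det = B.det := by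
        refine Matrix.det_eq_of_forall_row_eq_smul_add_const
          (fun i => if i = k then 0 else - A (r i) y) k (by simp) (fun i j => ?_)
        by_cases hi : i = k
        · subst hi
          simp [B, pivot_apply_row _ _ (hy j)]
        · have hi' : r i ≠ r k := fun h => hi (r.injective h)
          simp [B, hi, pivot_apply _ hi' (hy j), Matrix.updateRow_apply]
          ring
      rw [hB, Matrix.det_updateRow_smul]
      refine P.elems.mul_mem (inverse_mem_elems ha) ?_
      have : (A.submatrix r c).updateRow k ((A.submatrix r c).row k) = A.submatrix r c := by
        ext i j
        by_cases hi : i = k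
        · subst hi; simp
        · simp [Matrix.updateRow_apply, hi]
      rw [this]
      exact hA.det_mem _ _
  · push Not at hx
    by_cases hy : ∃ l, c l = y
    · obtain ⟨l, rfl⟩ := hy
      let B := (A.submatrix r c).updateCol l
        (-Ring.inverse (A x (c l)) • (A.submatrix r c).col l)
      have hB : ((pivot A x (c l)).submatrix r c).det = B.det := by
        rw [← Matrix.det_transpose, ← Matrix.det_transpose B]
        refine Matrix.det_eq_of_forall_row_eq_smul_add_const
          (fun j => if j = l then 0 else A x (c j)) l (by simp) (fun j i => ?_)
        by_cases hj : j = l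
        · subst hj
          simp [B, pivot_apply_col _ (hx i), mul_comm]
        · have hj' : c j ≠ c l := fun h => hj (c.injective h)
          simp [B, hj, pivot_apply _ (hx i) hj']
          ring
      rw [hB, Matrix.det_updateCol_smul]
      refine P.elems.mul_mem (neg_mem_elems (inverse_mem_elems ha)) ?_
      have : (A.submatrix r c).updateCol l ((A.submatrix r c).col l) = A.submatrix r c := by
        ext i j
        by_cases hj : j = l
        · subst hj; simp
        · simp [hj]
      rw [this]
      exact hA.det_mem _ _
    · push Not at hy
      have hr' : Function.Injective (Fin.cons x r : Fin (n + 1) → X) :=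
        Fin.cons_injective_iff.2 ⟨by rintro ⟨k, hk⟩; exact hx k hk, r.injective⟩
      have hc' : Function.Injective (Fin.cons y c : Fin (n + 1) → Y) :=
        Fin.cons_injective_iff.2 ⟨by rintro ⟨k, hk⟩; exact hy k hk, c.injective⟩
      have e := det_submatrix_eq_pivot (A := A) hr' hc' 0 0 (by simpa using hu)
      have e2 := hA.det_mem (Fin.cons x r : Fin (n + 1) → X) (Fin.cons y c : Fin (n + 1) → Y)
      rw [e] at e2
      simp only [Fin.val_zero, add_zero, pow_zero, one_mul, Fin.cons_zero] at e2
      have e3 := (mul_mem_elems_iff ha h0).1 e2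
      convert e3 using 3 <;> · ext; simp

/-- This is what allows deletion to be replaced by zeroing. -/
theorem pivot_updateCol_zero [DecidableEq Y] (A : Matrix X Y R) (x : X) {y z : Y} (hz : z ≠ y) :
    pivot (A.updateCol z 0) x y = (pivot A x y).updateCol z 0 := by
  ext i j
  by_cases hi : i = x <;> by_cases hj : j = y <;> by_cases hjz : j = z <;>
    simp_all [pivot, Ne.symm]

end Schur

/-! ### Fundamentals, and what the hypotheses on `φ` say about them. -/

section LiftData

variable {R : Type w} [CommRing R] (P : PartialField R) {𝔽 : Type*} [Field 𝔽]

/-- The fundamental elements of `P`, as a subset of the ring. -/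
def fundamentalSet : Set R := {p | p ∈ P.elems ∧ 1 - p ∈ P.elems}

/-- `f : R → 𝔽` restricts to a homomorphism from `P` to `𝔽` for which the inverse of `f` on
fundamental elements is compatible with addition and multiplication. -/
structure IsLiftable (f : R → 𝔽) : Prop where
  map_one : f 1 = 1
  map_mul : ∀ p ∈ P.elems, ∀ q ∈ P.elems, f (p * q) = f p * f q
  map_add : ∀ p ∈ P.elems, ∀ q ∈ P.elems, p + q ∈ P.elems → f (p + q) = f p + f q
  injOn : Set.InjOn f P.fundamentalSet
  add_eq_one : ∀ p ∈ P.fundamentalSet, ∀ q ∈ P.fundamentalSet, f p + f q = 1 → p + q = 1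
  mul_eq_one : ∀ p ∈ P.fundamentalSet, ∀ q ∈ P.fundamentalSet, ∀ r ∈ P.fundamentalSet,
    f p * f q * f r = 1 → p * q * r = 1
  one_eq_neg_one : (1 : 𝔽) = -1 → (1 : R) = -1

variable {P}

theorem one_mem_fundamentalSet : (1 : R) ∈ P.fundamentalSet :=
  ⟨P.elems.one_mem, by rw [sub_self]; exact zero_mem_elems⟩

theorem inverse_mem_fundamentalSet {p : R} (hp : p ∈ P.fundamentalSet) (h0 : p ≠ 0) :
    Ring.inverse p ∈ P.fundamentalSet := by
  refine ⟨inverse_mem_elems hp.1, ?_⟩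
  have := P.elems.mul_mem (inverse_mem_elems hp.1) (neg_mem_elems hp.2)
  rwa [neg_sub, mul_sub, Ring.inverse_mul_cancel _ (isUnit_of_mem_elems hp.1 h0), mul_one] at this

theorem mul_inverse_mem_fundamentalSet {s t : R} (hs : s ∈ P.elems) (hs0 : s ≠ 0)
    (ht : t ∈ P.elems) (h : s - t ∈ P.elems) : t * Ring.inverse s ∈ P.fundamentalSet := by
  refine ⟨P.elems.mul_mem ht (inverse_mem_elems hs), ?_⟩
  have := P.elems.mul_mem h (inverse_mem_elems hs)
  rwa [sub_mul, Ring.mul_inverse_cancel _ (isUnit_of_mem_elems hs hs0)] at this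

variable {f : R → 𝔽} (hf : P.IsLiftable f)
include hf

theorem IsLiftable.map_zero : f 0 = 0 := by
  have := hf.map_add 0 zero_mem_elems 0 zero_mem_elems (by simpa using zero_mem_elems)
  simpa using this

theorem IsLiftable.map_neg {p : R} (hp : p ∈ P.elems) : f (-p) = -f p := by
  have := hf.map_add p hp (-p) (neg_mem_elems hp) (by simpa using zero_mem_elems)
  rw [add_neg_cancel, hf.map_zero] at this
  exact (neg_eq_of_add_eq_zero_right this.symm).symm

theorem IsLiftable.map_sub {p q : R} (hp : p ∈ P.elems) (hq : q ∈ P.elems)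
    (h : p - q ∈ P.elems) : f (p - q) = f p - f q := by
  rw [sub_eq_add_neg] at h ⊢
  rw [hf.map_add p hp _ (neg_mem_elems hq) h, hf.map_neg hq, sub_eq_add_neg]

theorem IsLiftable.map_mul_inverse {p : R} (hp : p ∈ P.elems) (h0 : p ≠ 0) :
    f p * f (Ring.inverse p) = 1 := by
  rw [← hf.map_mul p hp _ (inverse_mem_elems hp),
    Ring.mul_inverse_cancel _ (isUnit_of_mem_elems hp h0), hf.map_one]

theorem IsLiftable.map_ne_zero {p : R} (hp : p ∈ P.elems) (h0 : p ≠ 0) : f p ≠ 0 :=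
  left_ne_zero_of_mul_eq_one (hf.map_mul_inverse hp h0)

theorem IsLiftable.map_eq_zero_iff {p : R} (hp : p ∈ P.elems) : f p = 0 ↔ p = 0 :=
  ⟨fun h => by_contra fun h0 => hf.map_ne_zero hp h0 h, fun h => by rw [h, hf.map_zero]⟩

theorem IsLiftable.map_inverse {p : R} (hp : p ∈ P.elems) : f (Ring.inverse p) = (f p)⁻¹ := by
  by_cases h0 : p = 0
  · rw [h0, Ring.inverse_zero, hf.map_zero, inv_zero]
  · exact (inv_eq_of_mul_eq_one_right (hf.map_mul_inverse hp h0)).symm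

theorem IsLiftable.mul_ne_zero {p q : R} (hp : p ∈ P.elems) (hq : q ∈ P.elems) (hp0 : p ≠ 0)
    (hq0 : q ≠ 0) : p * q ≠ 0 := by
  intro h
  have := hf.map_mul p hp q hq
  rw [h, hf.map_zero] at this
  exact _root_.mul_ne_zero (hf.map_ne_zero hp hp0) (hf.map_ne_zero hq hq0) this.symm

theorem IsLiftable.one_ne_zero : (1 : R) ≠ 0 := fun h => by
  have := hf.map_one
  rw [h, hf.map_zero] at this
  exact zero_ne_one this

theorem IsLiftable.inverse_ne_zero {p : R} (hp : p ∈ P.elems) (h0 : p ≠ 0) :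
    Ring.inverse p ≠ 0 := fun h => by
  have := hf.map_mul_inverse hp h0
  rw [h, hf.map_zero, mul_zero] at this
  exact zero_ne_one this

/-- The lift of a fundamental ratio is determined by its image. -/
theorem IsLiftable.mul_eq_mul_of_map_div_eq {s t s' t' : R} (hs : s ∈ P.elems) (hs0 : s ≠ 0)
    (ht : t ∈ P.elems) (hs' : s' ∈ P.elems) (hs0' : s' ≠ 0) (ht' : t' ∈ P.elems)
    (h : s - t ∈ P.elems) (h' : s' - t' ∈ P.elems) (he : f t / f s = f t' / f s') :
    t * s' = t' * s := by
  have key := hf.injOn (mul_inverse_mem_fundamentalSet hs hs0 ht h)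
    (mul_inverse_mem_fundamentalSet hs' hs0' ht' h') (by
      rw [hf.map_mul _ ht _ (inverse_mem_elems hs), hf.map_mul _ ht' _ (inverse_mem_elems hs'),
        hf.map_inverse hs, hf.map_inverse hs', ← div_eq_mul_inv, ← div_eq_mul_inv, he])
  have e := Ring.inverse_mul_cancel s (isUnit_of_mem_elems hs hs0)
  have e' := Ring.inverse_mul_cancel s' (isUnit_of_mem_elems hs' hs0')
  linear_combination (s * s') * key - t * s' * e + t' * s * e'

/-- Fundamental ratios compose as long as the image of the product is a fundamental ratio. -/
theorem IsLiftable.sub_mem_trans {s t w : R} (hs : s ∈ P.elems) (hs0 : s ≠ 0)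
    (ht : t ∈ P.elems) (ht0 : t ≠ 0) (hw : w ∈ P.elems) (hw0 : w ≠ 0)
    (hst : s - t ∈ P.elems) (htw : t - w ∈ P.elems) (h : f w / f s ∈ f '' P.fundamentalSet) :
    s - w ∈ P.elems := by
  obtain ⟨p, hp, hpe⟩ := h
  have fs := hf.map_ne_zero hs hs0
  have ft := hf.map_ne_zero ht ht0
  have fw := hf.map_ne_zero hw hw0
  have hp0 : p ≠ 0 := by
    rintro rfl
    rw [hf.map_zero] at hpe
    exact div_ne_zero fw fs hpe.symm
  -- The fundamentals `t / s`, `w / t` and `p⁻¹` have images with product `1`, which forces `w = s *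
  -- p` and `s - w = s * (1 - p)`.
  have key := hf.mul_eq_one _ (mul_inverse_mem_fundamentalSet hs hs0 ht hst) _
    (mul_inverse_mem_fundamentalSet ht ht0 hw htw) _ (inverse_mem_fundamentalSet hp hp0) (by
      rw [hf.map_mul _ ht _ (inverse_mem_elems hs), hf.map_mul _ hw _ (inverse_mem_elems ht),
        hf.map_inverse hs, hf.map_inverse ht, hf.map_inverse hp.1, hpe]
      field_simp)
  have es := Ring.inverse_mul_cancel s (isUnit_of_mem_elems hs hs0)
  have et := Ring.inverse_mul_cancel t (isUnit_of_mem_elems ht ht0)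
  have ep := Ring.inverse_mul_cancel p (isUnit_of_mem_elems hp.1 hp0)
  have e1 : w * Ring.inverse s * Ring.inverse p = 1 := by
    linear_combination key - w * Ring.inverse s * Ring.inverse p * et
  have e2 : w = s * p := by
    linear_combination s * p * e1 - w * s * Ring.inverse s * ep - w * es
  rw [e2]
  have := P.elems.mul_mem hs hp.2
  rwa [mul_sub, mul_one] at this

/-- If `2 ≠ 0` in the field and `p` lies over `-1`, then `q = 1 - p` lies over `2`. As `1/2 + 1/2 =
1`, the hypothesis on sums gives `2 * q⁻¹ = 1`, that is, `q = 2`. -/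
theorem IsLiftable.two_mem (h : (-1 : 𝔽) ∈ f '' P.fundamentalSet) : (2 : R) ∈ P.elems := by
  by_cases h1 : (1 : 𝔽) = -1
  · have : (2 : R) = 0 := by linear_combination hf.one_eq_neg_one h1
    rw [this]
    exact zero_mem_elems
  · obtain ⟨p, hp, hpe⟩ := h
    have hfq : f (1 - p) = 2 := by
      rw [hf.map_sub P.elems.one_mem hp.1 hp.2, hf.map_one, hpe]; ring
    have h2 : (2 : 𝔽) ≠ 0 := fun h => h1 (by linear_combination h)
    have hq0 : 1 - p ≠ 0 := fun h => h2 (by rw [← hfq, h, hf.map_zero])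
    have hq : 1 - p ∈ P.fundamentalSet := ⟨hp.2, by rw [sub_sub_cancel]; exact hp.1⟩
    have hi := inverse_mem_fundamentalSet hq hq0
    have := hf.add_eq_one _ hi _ hi (by rw [hf.map_inverse hp.2, hfq]; field_simp; norm_num)
    have e := Ring.inverse_mul_cancel _ (isUnit_of_mem_elems hp.2 hq0)
    have : 1 - p = 2 := by linear_combination 2 * e - (1 - p) * this
    rw [← this]
    exact hp.2

variable {X : Type u} {Y : Type v}

theorem IsLiftable.map_pivot {M : Matrix X Y R} {x : X} {y : Y} (hM : ∀ i j, M i j ∈ P.elems)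
    (hp : ∀ i j, pivot M x y i j ∈ P.elems) : (pivot M x y).map f = pivot (M.map f) x y := by
  ext i j
  have hi := inverse_mem_elems (hM x y)
  by_cases h1 : i = x
  · subst h1
    by_cases h2 : j = y
    · subst h2
      simp [pivot_apply_self, hf.map_inverse (hM i j)]
    · simp [pivot_apply_row _ _ h2, hf.map_mul _ hi _ (hM _ _), hf.map_inverse (hM i y)]
  · by_cases h2 : j = y
    · subst h2
      simp [pivot_apply_col _ h1, hf.map_neg (P.elems.mul_mem (hM _ _) hi),
        hf.map_mul _ (hM _ _) _ hi, hf.map_inverse (hM x j)]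
    · have := hp i j
      rw [pivot_apply _ h1 h2] at this
      simp [pivot_apply _ h1 h2, hf.map_inverse (hM x y),
        hf.map_sub (hM _ _) (P.elems.mul_mem (P.elems.mul_mem (hM _ _) hi) (hM _ _)) this,
        hf.map_mul _ (P.elems.mul_mem (hM _ _) hi) _ (hM _ _), hf.map_mul _ (hM _ _) _ hi]

end LiftData

/-! ### Confinement under scaling, pivoting, transposition and zeroing of columns. -/

section Reach

variable {𝔽 : Type w} [Field 𝔽] {X : Type u} {Y : Type v}

/-- `Reach A B` means that `B` is obtained from `A` by scaling rows and columns and pivoting. -/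
inductive Reach (A : Matrix X Y 𝔽) : Matrix X Y 𝔽 → Prop
  | refl : Reach A A
  | scale {B : Matrix X Y 𝔽} (h : Reach A B) (r : X → 𝔽) (c : Y → 𝔽) (hr : ∀ i, r i ≠ 0)
      (hc : ∀ j, c j ≠ 0) : Reach A (Matrix.of fun i j => r i * B i j * c j)
  | pivot {B : Matrix X Y 𝔽} (h : Reach A B) (x : X) (y : Y) (hxy : B x y ≠ 0) :
      Reach A (pivot B x y)

theorem Reach.trans {A B C : Matrix X Y 𝔽} (h : Reach A B) (h' : Reach B C) : Reach A C := by
  induction h' with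
  | refl => exact h
  | scale _ r c hr hc ih => exact ih.scale r c hr hc
  | pivot _ x y hxy ih => exact ih.pivot x y hxy

theorem Reach.transpose {A B : Matrix X Y 𝔽} (h : Reach A B) :
    Reach A.transpose B.transpose := by
  classical
  induction h with
  | refl => exact .refl
  | @scale B _ r c hr hc ih =>
    convert ih.scale c r hc hr using 1
    ext i j
    simp [mul_comm, mul_left_comm]
  | @pivot B _ x y hxy ih =>
    -- A pivot negates the pivot column but not the pivot row, so transposition commutes with it
    -- only up to these signs.
    convert (ih.pivot y x hxy).scale (fun j => if j = y then -1 else 1)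
      (fun i => if i = x then -1 else 1) (fun j => by split_ifs <;> simp)
      (fun i => by split_ifs <;> simp) using 1
    ext j i
    by_cases hi : i = x <;> by_cases hj : j = y <;>
      simp [PartialField.pivot, hi, hj] <;> ring

/-- A zero column is never pivoted on, so the same operations can be carried out on `A` itself.
Confinement therefore passes to the matrix with a column zeroed. -/
theorem Reach.exists_updateCol_zero [DecidableEq Y] {A B : Matrix X Y 𝔽} {y : Y}
    (h : Reach (A.updateCol y 0) B) : ∃ C, Reach A C ∧ B = C.updateCol y 0 := by
  induction h with
  | refl => exact ⟨A, .refl, rfl⟩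
  | scale _ r c hr hc ih =>
    obtain ⟨C, hC, rfl⟩ := ih
    refine ⟨_, hC.scale r c hr hc, ?_⟩
    ext i j
    by_cases hj : j = y <;> simp [hj]
  | pivot _ x z hxz ih =>
    obtain ⟨C, hC, rfl⟩ := ih
    have hz : y ≠ z := by
      rintro rfl
      simp at hxz
    rw [Matrix.updateCol_ne hz.symm] at hxz
    exact ⟨_, hC.pivot x z hxz, pivot_updateCol_zero C x hz⟩

/-- Every nondegenerate cross ratio of every matrix reachable from `A` lies in `F`. -/
def CrossConfined (F : Set 𝔽) (A : Matrix X Y 𝔽) : Prop :=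
  ∀ B, Reach A B → ∀ i k j l, B i j ≠ 0 → B k l ≠ 0 → B i l ≠ 0 → B k j ≠ 0 →
    (B i l * B k j) / (B i j * B k l) ∈ F

variable {F : Set 𝔽} {A : Matrix X Y 𝔽}

theorem CrossConfined.reach (hA : CrossConfined F A) {B : Matrix X Y 𝔽} (h : Reach A B) :
    CrossConfined F B := fun _ hC => hA _ (h.trans hC)

theorem CrossConfined.transpose (hA : CrossConfined F A) : CrossConfined F A.transpose := by
  intro B hB i k j l h1 h2 h3 h4
  have := hA _ (by simpa using hB.transpose) j l i k h1 h2 h4 h3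
  simpa [mul_comm] using this

theorem CrossConfined.updateCol_zero [DecidableEq Y] (hA : CrossConfined F A) (y : Y) :
    CrossConfined F (A.updateCol y 0) := by
  intro B hB i k j l h1 h2 h3 h4
  obtain ⟨C, hC, rfl⟩ := hB.exists_updateCol_zero
  have hj : j ≠ y := by rintro rfl; simp at h1
  have hl : l ≠ y := by rintro rfl; simp at h2
  simp only [Matrix.updateCol_ne hj, Matrix.updateCol_ne hl] at *
  exact hA _ hC _ _ _ _ h1 h2 h3 h4

end Reach

/-! ### Connectivity of the support graph, and shortening chains of rows. -/

section Chain

variable {𝔽 : Type w} [Field 𝔽] {X : Type u} {Y : Type v}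

/-- The rows `r 0, …, r m` are consecutively joined by the columns `z 0, …, z (m - 1)`, all of them
outside `T`. -/
def IsChain (A : Matrix X Y 𝔽) (T : Set Y) (m : ℕ) (r : ℕ → X) (z : ℕ → Y) : Prop :=
  ∀ k < m, z k ∉ T ∧ A (r k) (z k) ≠ 0 ∧ A (r (k + 1)) (z k) ≠ 0

/-- The rows `i` and `k` lie in the same component of the bipartite graph of `A` with the columns in
`T` removed: no separation has them on different sides. -/
def Linked (A : Matrix X Y 𝔽) (T : Set Y) (i k : X) : Prop :=
  ∀ (S : Set X) (U : Set Y), (∀ a, ∀ b ∉ T, A a b ≠ 0 → (a ∈ S ↔ b ∈ U)) → (i ∈ S ↔ k ∈ S)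

/-- A column meeting two non-consecutive rows is a chord. Consequently a shortest chain is induced,
which supplies the zero entries used in `IsChain.exists_le_two`. -/
theorem IsChain.shortcut {A : Matrix X Y 𝔽} {T : Set Y} {m : ℕ} {r : ℕ → X} {z : ℕ → Y}
    (h : IsChain A T m r z) {i j : ℕ} (hij : i + 2 ≤ j) (hj : j ≤ m) {b : Y} (hb : b ∉ T)
    (hi : A (r i) b ≠ 0) (hj' : A (r j) b ≠ 0) :
    ∃ m' < m, ∃ r' z', r' 0 = r 0 ∧ r' m' = r m ∧ IsChain A T m' r' z' := by
  obtain ⟨d, rfl⟩ := Nat.exists_eq_add_of_le hij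
  refine ⟨m - (d + 1), by omega, fun k => if k ≤ i then r k else r (k + (d + 1)),
    fun k => if k < i then z k else if k = i then b else z (k + (d + 1)), by simp, ?_, ?_⟩
  · have h1 : ¬ m - (d + 1) ≤ i := by omega
    have h2 : m - (d + 1) + (d + 1) = m := by omega
    simp only [if_neg h1, h2]
  · intro k hk
    rcases lt_trichotomy k i with hki | rfl | hki
    · simpa [hki, hki.le, Nat.succ_le_of_lt hki] using h k (by omega)
    · have : k + 1 + (d + 1) = k + 2 + d := by omega
      simpa [this] using ⟨hb, hi, hj'⟩
    · have h1 : ¬ k ≤ i := by omega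
      have h2 : ¬ k + 1 ≤ i := by omega
      have h3 : ¬ k < i := by omega
      have h4 : ¬ k = i := by omega
      have h5 : k + 1 + (d + 1) = k + (d + 1) + 1 := by omega
      simpa only [if_neg h1, if_neg h2, if_neg h3, if_neg h4, h5] using h (k + (d + 1)) (by omega)

/-- Pivoting off two given rows reduces the distance between them to at most two. -/
theorem IsChain.exists_le_two {T : Set Y} {a b : X} {I : Matrix X Y 𝔽 → Prop}
    (hI : ∀ A x y, I A → A x y ≠ 0 → y ∉ T → A a y = 0 → A b y = 0 → I (pivot A x y)) (m : ℕ) :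
    ∀ {A : Matrix X Y 𝔽} {r : ℕ → X} {z : ℕ → Y}, I A → IsChain A T m r z → r 0 = a → r m = b →
      ∃ B, I B ∧ ∃ m' ≤ 2, ∃ r' z', IsChain B T m' r' z' ∧ r' 0 = a ∧ r' m' = b := by
  induction m using Nat.strong_induction_on with
  | _ m ih =>
    intro A r z hA h h0 hm
    by_cases hm2 : m ≤ 2
    · exact ⟨A, hA, m, hm2, r, z, h, h0, hm⟩
    by_cases hs : ∃ m' < m, ∃ r' z', r' 0 = r 0 ∧ r' m' = r m ∧ IsChain A T m' r' z'
    · obtain ⟨m', hm', r', z', h1, h2, h3⟩ := hs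
      exact ih m' hm' hA h3 (h1.trans h0) (h2.trans hm)
    have hmin : ∀ i j c, i + 2 ≤ j → j ≤ m → c ∉ T → A (r i) c ≠ 0 → A (r j) c = 0 :=
      fun i j c h1 h2 h3 h4 => by_contra fun h5 => hs (h.shortcut h1 h2 h3 h4 h5)
    have hmin' : ∀ i j c, i + 2 ≤ j → j ≤ m → c ∉ T → A (r j) c ≠ 0 → A (r i) c = 0 :=
      fun i j c h1 h2 h3 h4 => by_contra fun h5 => hs (h.shortcut h1 h2 h3 h5 h4)
    obtain ⟨t0, e00, e10⟩ := h 0 (by omega)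
    obtain ⟨t1, e11, e21⟩ := h 1 (by omega)
    obtain ⟨t2, e22, e32⟩ := h 2 (by omega)
    simp only [zero_add] at e10
    norm_num at e21 e32
    have hrow : ∀ i c, A i (z 1) = 0 → pivot A (r 2) (z 1) i c = A i c := by
      intro i c hi
      have hne : i ≠ r 2 := by rintro rfl; exact e21 hi
      by_cases hc : c = z 1
      · rw [hc, pivot_apply_col _ hne, hi]; simp
      · rw [pivot_apply _ hne hc, hi]; simp
    have z0 : A (r 0) (z 1) = 0 := hmin' 0 2 _ le_rfl (by omega) t1 e21
    have zk : ∀ k, 3 ≤ k → k ≤ m → A (r k) (z 1) = 0 := fun k h1 h2 =>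
      hmin 1 k _ (by omega) h2 t1 e11
    have hne : r 1 ≠ r 2 := by
      intro h
      have := hmin' 0 2 _ le_rfl (by omega) t0 (by rw [← h]; exact e10)
      exact e00 this
    have n0 : z 0 ≠ z 1 := by
      intro h; rw [← h] at z0; exact e00 z0
    have n2 : z 2 ≠ z 1 := by
      intro h; have := zk 3 le_rfl (by omega); rw [← h] at this; exact e32 this
    have y0 : A (r 2) (z 0) = 0 := hmin 0 2 _ le_rfl (by omega) t0 e00
    have y2 : A (r 1) (z 2) = 0 := hmin' 1 3 _ le_rfl (by omega) t2 e32
    -- Pivoting on `(r 2, z 1)` creates a nonzero entry in position `(r 1, z 2)`, so `r 2` can be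
    -- dropped from the chain. The other rows of the chain, including both ends, vanish in column `z
    -- 1` and do not change.
    refine ih (m - 1) (by omega) (A := pivot A (r 2) (z 1))
      (r := fun k => if k ≤ 1 then r k else r (k + 1))
      (z := fun k => if k = 0 then z 0 else z (k + 1))
      (hI A _ _ hA e21 t1 (h0 ▸ z0) (hm ▸ zk m (by omega) le_rfl)) ?_ (by simpa using h0) ?_
    · intro k hk
      obtain rfl | rfl | hk2 : k = 0 ∨ k = 1 ∨ 2 ≤ k := by omega
      · simp only [zero_le, if_true, zero_add, le_refl]
        refine ⟨t0, ?_, ?_⟩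
        · rwa [hrow _ _ z0]
        · rw [pivot_apply _ hne n0, y0]; simpa using e10
      · norm_num
        refine ⟨t2, ?_, ?_⟩
        · rw [pivot_apply _ hne n2, y2]
          simpa using ⟨⟨e11, e21⟩, e22⟩
        · rwa [hrow _ _ (zk 3 le_rfl (by omega))]
      · have h1 : ¬ k ≤ 1 := by omega
        have h2 : ¬ k + 1 ≤ 1 := by omega
        have h3 : ¬ k = 0 := by omega
        simp only [if_neg h1, if_neg h2, if_neg h3]
        obtain ⟨q1, q2, q3⟩ := h (k + 1) (by omega)
        exact ⟨q1, by rwa [hrow _ _ (zk (k + 1) (by omega) (by omega))],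
          by rwa [hrow _ _ (zk (k + 1 + 1) (by omega) (by omega))]⟩
    · have h1 : ¬ m - 1 ≤ 1 := by omega
      have h2 : m - 1 + 1 = m := by omega
      simp only [if_neg h1, h2, hm]

variable {A : Matrix X Y 𝔽} {T : Set Y}

theorem Linked.symm {i k : X} (h : Linked A T i k) : Linked A T k i := fun S U hS => (h S U hS).symm

theorem Linked.trans {i k l : X} (h : Linked A T i k) (h' : Linked A T k l) : Linked A T i l :=
  fun S U hS => (h S U hS).trans (h' S U hS)

theorem Linked.refl (i : X) : Linked A T i i := fun _ _ _ => Iff.rfl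

theorem linked_of_ne_zero {i k : X} {j : Y} (hj : j ∉ T) (hi : A i j ≠ 0) (hk : A k j ≠ 0) :
    Linked A T i k := fun _ _ h => (h i j hj hi).trans (h k j hj hk).symm

/-- The vertices with a given label form one side of a separation. -/
theorem Linked.label_eq {α : Type*} {i k : X} (h : Linked A T i k) {r : X → α} {c : Y → α}
    (hrc : ∀ a, ∀ b ∉ T, A a b ≠ 0 → r a = c b) : r i = r k := by
  have := h {a | r a = r i} {b | c b = r i} fun a b hb hab => by simp [hrc a b hb hab]
  exact (this.1 rfl).symm

theorem Linked.exists_isChain [Nonempty Y] {i k : X} (h : Linked A T i k) :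
    ∃ m r z, IsChain A T m r z ∧ r 0 = i ∧ r m = k := by
  let S : Set X := {a | ∃ m r z, IsChain A T m r z ∧ r 0 = i ∧ r m = a}
  obtain ⟨y⟩ := ‹Nonempty Y›
  have hi : i ∈ S := ⟨0, fun _ => i, fun _ => y, fun _ h => absurd h (by omega), rfl, rfl⟩
  refine (h S {b | ∃ a ∈ S, A a b ≠ 0} fun a b hb hab => ⟨fun ha => ⟨a, ha, hab⟩, ?_⟩).1 hi
  rintro ⟨a', ⟨m, r, z, hc, h0, hm⟩, hab'⟩
  refine ⟨m + 1, fun k => if k ≤ m then r k else a, fun k => if k < m then z k else b, ?_,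
    by simpa using h0, by simp⟩
  intro k hk
  obtain hk' | rfl : k < m ∨ k = m := by omega
  · simpa [hk', hk'.le, Nat.succ_le_of_lt hk'] using hc k hk'
  · simpa [hm] using ⟨hb, hab', hab⟩

/-- Every separation of the pivoted matrix separates `A`: a nonzero entry `A a b` can be cancelled
only if `A a y` and `A x b` are nonzero, and then `a` and `b` stay joined through `x` and `y`. -/
theorem Linked.pivot {i k : X} (h : Linked A T i k) {x : X} {y : Y} (hy : y ∉ T)
    (hxy : A x y ≠ 0) : Linked (pivot A x y) T i k := by
  intro S U hS
  refine h S U fun a b hb hab => ?_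
  have hxyS : x ∈ S ↔ y ∈ U := hS x y hy (by rw [pivot_apply_self]; simpa using hxy)
  by_cases ha : a = x
  · subst ha
    by_cases hby : b = y
    · rwa [hby]
    · exact hS a b hb (by rw [pivot_apply_row _ _ hby]; simpa using ⟨hxy, hab⟩)
  by_cases hby : b = y
  · subst hby
    exact hS a b hb (by rw [pivot_apply_col _ ha]; simpa using ⟨hab, hxy⟩)
  by_cases h1 : A a y = 0
  · exact hS a b hb (by rw [pivot_apply _ ha hby, h1]; simpa using hab)
  by_cases h2 : A x b = 0
  · exact hS a b hb (by rw [pivot_apply _ ha hby, h2]; simpa using hab)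
  · have e1 := hS a y hy (by rw [pivot_apply_col _ ha]; simpa using ⟨h1, hxy⟩)
    have e2 := hS x b hb (by rw [pivot_apply_row _ _ hby]; simpa using ⟨hxy, h2⟩)
    rw [e1, ← hxyS, e2]

end Chain

/-! ### Uniqueness of lifts up to scaling. -/

section Uniqueness

variable {R : Type w} [CommRing R] {P : PartialField R} {𝔽 : Type*} [Field 𝔽] {f : R → 𝔽}
  {X : Type u} {Y : Type v}

theorem pivot_row_eq {A : Matrix X Y R} {x i : X} {y : Y} (hi : i ≠ x) (h : A i y = 0) (j : Y) :
    pivot A x y i j = A i j := by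
  by_cases hj : j = y
  · rw [hj, pivot_apply_col _ hi, h]; simp
  · rw [pivot_apply _ hi hj, h]; simp

/-- Two lifts that agree off the columns in `T`, together with the data by which their images
differ in the column `y`. -/
structure ColumnPair (P : PartialField R) (f : R → 𝔽) (T : Set Y) (y : Y) (r : X → 𝔽) (c : Y → 𝔽)
    (M M' : Matrix X Y R) : Prop where
  left : P.IsPMatrix M
  right : P.IsPMatrix M'
  mem : y ∈ T
  eq_off : ∀ i, ∀ j ∉ T, M' i j = M i j
  label : ∀ i, ∀ j ∉ T, M i j ≠ 0 → r i = c j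
  map_col : ∀ i, f (M' i y) = r i * f (M i y)
  ne_zero : ∀ i, r i ≠ 0

variable {T : Set Y} {y : Y} {r : X → 𝔽} {c : Y → 𝔽} {M M' : Matrix X Y R}

/-- Rows joined through column `z` carry the same label `r`, so a pivot combines only entries of
column `y` whose images differ by the same factor. -/
theorem ColumnPair.pivot_of_ne_zero (hf : P.IsLiftable f) (h : ColumnPair P f T y r c M M') {x : X} {z : Y}
    (hz : z ∉ T) (hxz : M x z ≠ 0) : ColumnPair P f T y r c (pivot M x z) (pivot M' x z) := by
  have hyz : y ≠ z := by rintro rfl; exact hz h.mem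
  have hz' : ∀ i, M' i z = M i z := fun i => h.eq_off i z hz
  have hM := h.left.apply_mem
  have hM' := h.right.apply_mem
  have hp := isPMatrix_pivot h.left hxz
  have hp' : P.IsPMatrix (pivot M' x z) := isPMatrix_pivot h.right (by rwa [hz'])
  have e1 := hf.map_pivot hM hp.apply_mem
  have e2 := hf.map_pivot hM' hp'.apply_mem
  refine ⟨hp, hp', h.mem, fun i j hj => ?_, fun i j hj hij => ?_, fun i => ?_, h.ne_zero⟩
  · simp only [pivot, hz', h.eq_off _ j hj]
  · by_cases hi : i = x
    · subst hi
      by_cases hjz : j = z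
      · subst hjz; exact h.label _ _ hj hxz
      · refine h.label _ _ hj fun h0 => hij ?_
        rw [pivot_apply_row _ _ hjz, h0, mul_zero]
    · by_cases hiz : M i z = 0
      · rw [pivot_row_eq hi hiz] at hij
        exact h.label _ _ hj hij
      · have h1 := h.label i z hz hiz
        by_cases hxj : M x j = 0
        · by_cases hjz : j = z
          · rwa [hjz]
          refine h.label _ _ hj fun h0 => hij ?_
          rw [pivot_apply _ hi hjz, h0, hxj]; simp
        · rw [h1, ← h.label x z hz hxz, h.label x j hj hxj]
  · have e1' := congrFun (congrFun e1 i) y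
    have e2' := congrFun (congrFun e2 i) y
    rw [Matrix.map_apply] at e1' e2'
    rw [e1', e2']
    by_cases hi : i = x
    · subst hi
      rw [pivot_apply_row _ _ hyz, pivot_apply_row _ _ hyz]
      simp only [Matrix.map_apply, hz', h.map_col]
      ring
    · rw [pivot_apply _ hi hyz, pivot_apply _ hi hyz]
      simp only [Matrix.map_apply, hz', h.map_col]
      by_cases hiz : M i z = 0
      · rw [hiz, hf.map_zero]; ring
      · rw [h.label i z hz hiz, ← h.label x z hz hxz]; ring

/-- The columns `z` and `y` give a fundamental in each of `M` and `M'`. Their images agree because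
`r a = r b`, so the fundamentals themselves agree. -/
theorem ColumnPair.ratio_eq_of_col (hf : P.IsLiftable f) (h : ColumnPair P f T y r c M M')
    {a b : X} {z : Y} (hz : z ∉ T) (ha : M a z ≠ 0) (hb : M b z ≠ 0)
    (hby : M b y ≠ 0) : M a y * M' b y = M b y * M' a y := by
  have hM := h.left.apply_mem
  have hM' := h.right.apply_mem
  have hby' : M' b y ≠ 0 := by
    intro h0
    have := h.map_col b
    rw [h0, hf.map_zero] at this
    exact mul_ne_zero (h.ne_zero b) (hf.map_ne_zero (hM b y) hby) this.symm
  have h1 := h.left.two_mem a b z y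
  have h2 := h.right.two_mem a b z y
  rw [h.eq_off a z hz, h.eq_off b z hz] at h2
  have hr : r a = r b := by rw [h.label a z hz ha, h.label b z hz hb]
  have key := hf.mul_eq_mul_of_map_div_eq (P.elems.mul_mem (hM a z) (hM b y))
    (hf.mul_ne_zero (hM _ _) (hM _ _) ha hby) (P.elems.mul_mem (hM a y) (hM b z))
    (P.elems.mul_mem (hM a z) (hM' b y)) (hf.mul_ne_zero (hM _ _) (hM' _ _) ha hby')
    (P.elems.mul_mem (hM' a y) (hM b z)) h1 h2 (by
      rw [hf.map_mul _ (hM _ _) _ (hM _ _), hf.map_mul _ (hM _ _) _ (hM _ _),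
        hf.map_mul _ (hM _ _) _ (hM' _ _), hf.map_mul _ (hM' _ _) _ (hM _ _), h.map_col, h.map_col,
        hr]
      have := h.ne_zero b
      have := hf.map_ne_zero (hM a z) ha
      have := hf.map_ne_zero (hM b y) hby
      field_simp)
  have hu := (isUnit_of_mem_elems (hM a z) ha).mul (isUnit_of_mem_elems (hM b z) hb)
  refine hu.mul_left_cancel ?_
  linear_combination key

/-- Pivots that leave rows `a` and `b` unchanged bring them to distance at most two, where
`ColumnPair.ratio_eq_of_col` is applied along the chain. -/
theorem ColumnPair.ratio_eq (hf : P.IsLiftable f) (h : ColumnPair P f T y r c M M') {a b : X}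
    (hl : Linked (M.map f) T a b) (hby : M b y ≠ 0) :
    M a y * M' b y = M b y * M' a y := by
  have : Nonempty Y := ⟨y⟩
  obtain ⟨m, s, z, hs, h0, hm⟩ := hl.exists_isChain
  obtain ⟨_, ⟨N, N', hN, rfl, hN1, hN2, hN3, hN4⟩, m', hm', s', z', hs', h0', hm''⟩ :=
    IsChain.exists_le_two (a := a) (b := b) (T := T)
      (I := fun A => ∃ N N', ColumnPair P f T y r c N N' ∧ N.map f = A ∧ N a y = M a y ∧
        N b y = M b y ∧ N' a y = M' a y ∧ N' b y = M' b y)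
      (by
        rintro _ x w ⟨N, N', hN, rfl, h1, h2, h3, h4⟩ hxw hw haw hbw
        rw [Matrix.map_apply, hf.map_eq_zero_iff (hN.left.apply_mem _ _)] at haw hbw
        rw [Matrix.map_apply, Ne, hf.map_eq_zero_iff (hN.left.apply_mem _ _)] at hxw
        have hax : a ≠ x := by rintro rfl; exact hxw haw
        have hbx : b ≠ x := by rintro rfl; exact hxw hbw
        refine ⟨_, _, hN.pivot_of_ne_zero hf hw hxw, hf.map_pivot hN.left.apply_mem
          (isPMatrix_pivot hN.left hxw).apply_mem, ?_, ?_, ?_, ?_⟩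
        · rw [pivot_row_eq hax haw, h1]
        · rw [pivot_row_eq hbx hbw, h2]
        · rw [pivot_row_eq hax (by rw [hN.eq_off _ _ hw, haw]), h3]
        · rw [pivot_row_eq hbx (by rw [hN.eq_off _ _ hw, hbw]), h4])
      m ⟨M, M', h, rfl, rfl, rfl, rfl, rfl⟩ hs h0 hm
  rw [← hN2] at hby
  rw [← hN1, ← hN2, ← hN3, ← hN4]
  have hz : ∀ i j, N.map f i j ≠ 0 → N i j ≠ 0 := fun i j hij h0 => hij (by
    rw [Matrix.map_apply, h0, hf.map_zero])
  obtain rfl | rfl | rfl : m' = 0 ∨ m' = 1 ∨ m' = 2 := by omega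
  · rw [h0'] at hm''
    rw [hm'']
  · obtain ⟨t0, e0, e1⟩ := hs' 0 (by omega)
    rw [h0'] at e0
    rw [zero_add, hm''] at e1
    exact hN.ratio_eq_of_col hf t0 (hz _ _ e0) (hz _ _ e1) hby
  · obtain ⟨t0, e0, e1⟩ := hs' 0 (by omega)
    obtain ⟨t1, e2, e3⟩ := hs' 1 (by omega)
    rw [h0'] at e0
    rw [show 1 + 1 = 2 from rfl, hm''] at e3
    rw [zero_add] at e1
    replace e0 := hz _ _ e0
    replace e1 := hz _ _ e1
    replace e2 := hz _ _ e2
    replace e3 := hz _ _ e3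
    generalize s' 1 = k at *
    by_cases hk : N k y = 0
    · by_cases h1 : N a (z' 1) = 0
      · by_cases h2 : N b (z' 0) = 0
        · have hz01 : z' 1 ≠ z' 0 := by intro h; rw [h] at h1; exact e0 h1
          have hyz : y ≠ z' 0 := by rintro h; exact t0 (h ▸ hN.mem)
          have hak : a ≠ k := by rintro rfl; exact e2 h1
          have hbk : b ≠ k := by rintro rfl; exact e1 h2
          have hk' : N' k y = 0 := by
            rw [← hf.map_eq_zero_iff (hN.right.apply_mem _ _), hN.map_col, hk, hf.map_zero,
              mul_zero]
          -- The middle row `k` is zero in column `y`, so no comparison passes through it. Pivoting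
          -- on `(k, z' 0)` gives `a` and `b` the common column `z' 1` and preserves their entries
          -- in column `y`.
          have hQ := hN.pivot_of_ne_zero hf t0 e1
          have q1 : pivot N k (z' 0) a y = N a y := by
            rw [pivot_apply _ hak hyz, hk]; simp
          have q1' : pivot N' k (z' 0) a y = N' a y := by
            rw [pivot_apply _ hak hyz, hk']; simp
          have q2 : pivot N k (z' 0) b y = N b y := pivot_row_eq hbk h2 _
          have q2' : pivot N' k (z' 0) b y = N' b y :=
            pivot_row_eq hbk (by rw [hN.eq_off _ _ t0, h2]) _
          have := hQ.ratio_eq_of_col hf (a := a) (b := b) t1 (by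
            rw [pivot_apply _ hak hz01, h1, zero_sub, neg_ne_zero]
            exact hf.mul_ne_zero (P.elems.mul_mem (hN.left.apply_mem _ _)
              (inverse_mem_elems (hN.left.apply_mem _ _))) (hN.left.apply_mem _ _)
              (hf.mul_ne_zero (hN.left.apply_mem _ _) (inverse_mem_elems (hN.left.apply_mem _ _)) e0
                (hf.inverse_ne_zero (hN.left.apply_mem _ _) e1)) e2) (by
            rwa [pivot_row_eq hbk h2]) (by rwa [q2])
          rwa [q1, q1', q2, q2'] at this
        · exact hN.ratio_eq_of_col hf t0 e0 h2 hby
      · exact hN.ratio_eq_of_col hf t1 h1 e3 hby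
    · have h1 := hN.ratio_eq_of_col hf t0 e0 e1 hk
      have h2 := hN.ratio_eq_of_col hf t1 e2 e3 hby
      refine (isUnit_of_mem_elems (hN.left.apply_mem k y) hk).mul_left_cancel ?_
      linear_combination (N a y) * h2 + (N b y) * h1

/-- Lifts of a matrix are unique up to scaling. -/
theorem IsLiftable.exists_scaling (hf : P.IsLiftable f) {M M' : Matrix X Y R} (hM : P.IsPMatrix M)
    (hM' : P.IsPMatrix M') {r : X → 𝔽} {c : Y → 𝔽} (hr : ∀ i, r i ≠ 0) (hc : ∀ j, c j ≠ 0)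
    (h : ∀ i j, f (M' i j) = r i * f (M i j) * c j) (S : Finset Y) :
    ∃ (ρ : X → R) (κ : Y → R), (∀ i, ρ i ∈ P.elems ∧ ρ i ≠ 0) ∧ (∀ j, κ j ∈ P.elems ∧ κ j ≠ 0) ∧
      ∀ i, ∀ j ∈ S, M' i j = ρ i * M i j * κ j := by
  classical
  have h10 := hf.one_ne_zero
  induction S using Finset.induction_on with
  | empty =>
    exact ⟨fun _ => 1, fun _ => 1, fun _ => ⟨P.elems.one_mem, h10⟩, fun _ => ⟨P.elems.one_mem, h10⟩,
      by simp⟩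
  | insert y S hy ih =>
    obtain ⟨ρ, κ, hρ, hκ, hS⟩ := ih
    let N : Matrix X Y R := Matrix.of fun i j => ρ i * M i j * κ j
    have hN : P.IsPMatrix N := hM.scale (fun i => (hρ i).1) (fun j => (hκ j).1)
    have hfρ : ∀ i, f (ρ i) ≠ 0 := fun i => hf.map_ne_zero (hρ i).1 (hρ i).2
    have hfκ : ∀ j, f (κ j) ≠ 0 := fun j => hf.map_ne_zero (hκ j).1 (hκ j).2
    have hNf : ∀ i j, f (M' i j) = r i / f (ρ i) * f (N i j) * (c j / f (κ j)) := by
      intro i j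
      have : f (N i j) = f (ρ i) * f (M i j) * f (κ j) := by
        simp only [N, Matrix.of_apply]
        rw [hf.map_mul _ (P.elems.mul_mem (hρ i).1 (hM.apply_mem _ _)) _ (hκ j).1,
          hf.map_mul _ (hρ i).1 _ (hM.apply_mem _ _)]
      rw [this, h]
      have := hfρ i
      have := hfκ j
      field_simp
    -- Columns are treated one at a time: `N` already agrees with `M'` on `S`, and only the
    -- components formed by the columns in `S` restrict the scaling of column `y`.
    let T : Set Y := {j | j ∉ S}
    have hp : ColumnPair P f T y (fun i => r i / f (ρ i) * (c y / f (κ y)))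
        (fun j => f (κ j) / c j * (c y / f (κ y))) N M' := by
      refine ⟨hN, hM', hy, fun i j hj => ?_, fun i j hj hij => ?_, fun i => ?_, fun i => ?_⟩
      · exact hS i j (by simpa [T] using hj)
      · have e := hNf i j
        rw [hS i j (by simpa [T] using hj)] at e
        change f (N i j) = _ at e
        have h0 := hf.map_ne_zero (hN.apply_mem i j) hij
        have := hfκ j
        have := hc j
        have e2 : r i / f (ρ i) * (c j / f (κ j)) = 1 := by
          apply mul_right_cancel₀ h0
          linear_combination -e
        have e3 : r i / f (ρ i) = f (κ j) / c j := by
          rw [eq_div_iff (hc j)]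
          field_simp at e2 ⊢
          linear_combination e2
        simp only [e3]
      · rw [hNf i y]; ring
      · exact _root_.mul_ne_zero (div_ne_zero (hr i) (hfρ i)) (div_ne_zero (hc y) (hfκ y))
    have hzero : ∀ i, N i y = 0 → M' i y = 0 := fun i h0 => by
      rw [← hf.map_eq_zero_iff (hM'.apply_mem _ _), hNf, h0, hf.map_zero]; ring
    have hzero' : ∀ i, N i y ≠ 0 → M' i y ≠ 0 := fun i h0 h1 => by
      have := hp.map_col i
      rw [h1, hf.map_zero] at this
      exact _root_.mul_ne_zero (hp.ne_zero i) (hf.map_ne_zero (hN.apply_mem _ _) h0) this.symm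
    -- The ratio of the two columns `y`, constant on each component by `ColumnPair.ratio_eq`; a
    -- component that misses column `y` is not rescaled.
    let σ : X → R := fun i => if h : ∃ k, N k y ≠ 0 ∧ Linked (N.map f) T i k then
      M' h.choose y * Ring.inverse (N h.choose y) else 1
    have hσ : ∀ i, σ i ∈ P.elems ∧ σ i ≠ 0 := by
      intro i
      by_cases h : ∃ k, N k y ≠ 0 ∧ Linked (N.map f) T i k
      · simp only [σ, dif_pos h]
        have h1 := h.choose_spec.1
        exact ⟨P.elems.mul_mem (hM'.apply_mem _ _) (inverse_mem_elems (hN.apply_mem _ _)),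
          hf.mul_ne_zero (hM'.apply_mem _ _) (inverse_mem_elems (hN.apply_mem _ _)) (hzero' _ h1)
            (hf.inverse_ne_zero (hN.apply_mem _ _) h1)⟩
      · simp only [σ, dif_neg h]
        exact ⟨P.elems.one_mem, h10⟩
    have hratio : ∀ i k, N i y ≠ 0 → N k y ≠ 0 → Linked (N.map f) T i k →
        M' i y * Ring.inverse (N i y) = M' k y * Ring.inverse (N k y) := by
      intro i k hi hk hik
      have := hp.ratio_eq hf hik hk
      have e1 := Ring.inverse_mul_cancel _ (isUnit_of_mem_elems (hN.apply_mem i y) hi)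
      have e2 := Ring.inverse_mul_cancel _ (isUnit_of_mem_elems (hN.apply_mem k y) hk)
      linear_combination -Ring.inverse (N i y) * Ring.inverse (N k y) * this
        - M' i y * Ring.inverse (N i y) * e2 + M' k y * Ring.inverse (N k y) * e1
    have hσeq : ∀ i k, Linked (N.map f) T i k → σ i = σ k := by
      intro i k hik
      by_cases h : ∃ l, N l y ≠ 0 ∧ Linked (N.map f) T i l
      · have h' : ∃ l, N l y ≠ 0 ∧ Linked (N.map f) T k l :=
          ⟨_, h.choose_spec.1, hik.symm.trans h.choose_spec.2⟩
        simp only [σ, dif_pos h, dif_pos h']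
        exact hratio _ _ h.choose_spec.1 h'.choose_spec.1
          (h.choose_spec.2.symm.trans (hik.trans h'.choose_spec.2))
      · have h' : ¬ ∃ l, N l y ≠ 0 ∧ Linked (N.map f) T k l :=
          fun ⟨l, h1, h2⟩ => h ⟨l, h1, hik.trans h2⟩
        simp only [σ, dif_neg h, dif_neg h']
    -- Undoes the effect of `σ` on the columns already matched; the new column `y` gets `1`.
    let τ : Y → R := fun j => if h : j ∈ S ∧ ∃ i, N i j ≠ 0 then Ring.inverse (σ h.2.choose) else 1
    refine ⟨fun i => σ i * ρ i, fun j => κ j * τ j, fun i =>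
      ⟨P.elems.mul_mem (hσ i).1 (hρ i).1, hf.mul_ne_zero (hσ i).1 (hρ i).1 (hσ i).2 (hρ i).2⟩,
      fun j => ?_, fun i j hj => ?_⟩
    · have : τ j ∈ P.elems ∧ τ j ≠ 0 := by
        by_cases h : j ∈ S ∧ ∃ i, N i j ≠ 0
        · simp only [τ, dif_pos h]
          exact ⟨inverse_mem_elems (hσ _).1, hf.inverse_ne_zero (hσ _).1 (hσ _).2⟩
        · simp only [τ, dif_neg h]
          exact ⟨P.elems.one_mem, h10⟩
      exact ⟨P.elems.mul_mem (hκ j).1 this.1, hf.mul_ne_zero (hκ j).1 this.1 (hκ j).2 this.2⟩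
    · have goal : M' i j = σ i * N i j * τ j := by
        rcases Finset.mem_insert.1 hj with rfl | hjS
        · have hτ : τ j = 1 := dif_neg fun h => hy h.1
          rw [hτ, mul_one]
          by_cases h0 : N i j = 0
          · rw [hzero i h0, h0, mul_zero]
          · have h : ∃ k, N k j ≠ 0 ∧ Linked (N.map f) T i k := ⟨i, h0, .refl i⟩
            have : σ i = M' i j * Ring.inverse (N i j) := by
              simp only [σ, dif_pos h]
              exact hratio _ _ h.choose_spec.1 h0 h.choose_spec.2.symm
            rw [this, mul_assoc,
              Ring.inverse_mul_cancel _ (isUnit_of_mem_elems (hN.apply_mem i j) h0), mul_one]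
        · have e : M' i j = N i j := hS i j hjS
          rw [e]
          by_cases h0 : N i j = 0
          · simp [h0]
          · have h : j ∈ S ∧ ∃ i, N i j ≠ 0 := ⟨hjS, i, h0⟩
            have hjT : j ∉ T := by simpa [T] using hjS
            have : σ i = σ h.2.choose := hσeq _ _ (linked_of_ne_zero hjT
              (hf.map_ne_zero (hN.apply_mem _ _) h0)
              (hf.map_ne_zero (hN.apply_mem _ _) h.2.choose_spec))
            simp only [τ, dif_pos h]
            rw [← this]
            have := Ring.inverse_mul_cancel _ (isUnit_of_mem_elems (hσ i).1 (hσ i).2)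
            linear_combination -N i j * this
      rw [goal]
      simp only [N, Matrix.of_apply]
      ring

end Uniqueness

/-! ### Matrices that are `P`-matrices away from each of two columns. -/

section TwoColumns

variable {R : Type w} [CommRing R] {P : PartialField R} {𝔽 : Type*} [Field 𝔽] {f : R → 𝔽}
  {X : Type u} {Y : Type v} [DecidableEq Y] {x y : Y} {M : Matrix X Y R}

theorem apply_mem_of_updateCol (hxy : x ≠ y) (hx : P.IsPMatrix (M.updateCol x 0))
    (hy : P.IsPMatrix (M.updateCol y 0)) (i : X) (j : Y) : M i j ∈ P.elems := by
  by_cases hj : j = x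
  · subst hj
    simpa [Matrix.updateCol_apply, hxy] using hy.apply_mem i j
  · simpa [Matrix.updateCol_apply, hj] using hx.apply_mem i j

/-- If `M` is a `P`-matrix up to the column `x` and up to the column `y`, then pivoting off these
columns reduces the question whether it is a `P`-matrix to its `2 × 2` subdeterminants. -/
theorem isPMatrix_of_two_columns (hxy : x ≠ y) {I : Matrix X Y R → Prop}
    (hIx : ∀ M, I M → P.IsPMatrix (M.updateCol x 0))
    (hIy : ∀ M, I M → P.IsPMatrix (M.updateCol y 0))
    (hI : ∀ M a z, I M → M a z ≠ 0 → z ≠ x → z ≠ y → I (pivot M a z))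
    (hI2 : ∀ M i k, I M → M i x * M k y - M i y * M k x ∈ P.elems) (hM : I M) :
    P.IsPMatrix M := by
  intro n
  induction n generalizing M with
  | zero =>
    intro r c
    simp
  | succ n ih =>
    intro r c
    by_cases hcx : ∃ k, c k = x
    swap
    · push Not at hcx
      exact det_submatrix_mem_of_updateCol (hIx M hM) r c hcx
    by_cases hcy : ∃ k, c k = y
    swap
    · push Not at hcy
      exact det_submatrix_mem_of_updateCol (hIy M hM) r c hcy
    by_cases h3 : ∃ k, c k ≠ x ∧ c k ≠ y
    · obtain ⟨l, hlx, hly⟩ := h3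
      by_cases h0 : ∃ k, M (r k) (c l) ≠ 0
      · obtain ⟨k, hk⟩ := h0
        have hmem := apply_mem_of_updateCol hxy (hIx M hM) (hIy M hM) (r k) (c l)
        -- Pivoting in a third column lowers the size by one and keeps `x` and `y`, so the induction
        -- ends at the 2 × 2 determinants in these two columns.
        rw [det_submatrix_eq_pivot r.injective c.injective k l (isUnit_of_mem_elems hmem hk)]
        refine P.elems.mul_mem (neg_one_pow_mul_mem_elems _ hmem) ?_
        exact ih (hI M _ _ hM hk hlx hly) (k.succAboveEmb.trans r)
          (l.succAboveEmb.trans c)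
      · push Not at h0
        rw [Matrix.det_eq_zero_of_column_eq_zero l (fun k => h0 k)]
        exact zero_mem_elems
    · push Not at h3
      obtain ⟨k1, hk1⟩ := hcx
      obtain ⟨k2, hk2⟩ := hcy
      have hne : k1 ≠ k2 := by rintro rfl; exact hxy (hk1.symm.trans hk2)
      have hall : ∀ k, k = k1 ∨ k = k2 := fun k => by
        by_cases h : c k = x
        · exact Or.inl (c.injective (h.trans hk1.symm))
        · exact Or.inr (c.injective ((h3 k h).trans hk2.symm))
      have hn : n = 1 := by
        have h1 : (Finset.univ : Finset (Fin (n + 1))) = {k1, k2} := by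
          ext k; simpa using hall k
        have h2 := congrArg Finset.card h1
        rw [Finset.card_univ, Fintype.card_fin, Finset.card_pair hne] at h2
        omega
      subst hn
      rw [Matrix.det_fin_two]
      simp only [Matrix.submatrix_apply]
      have h01 : (0 : Fin 2) ≠ 1 := by decide
      rcases hall 0 with h | h <;> rcases hall 1 with h' | h'
      · exact absurd (h.trans h'.symm) h01
      · rw [h, h', hk1, hk2]
        exact hI2 M _ _ hM
      · rw [h, h', hk1, hk2, sub_mem_elems_comm]
        exact hI2 M _ _ hM
      · exact absurd (h.trans h'.symm) h01

/-- `M` is a `P`-matrix up to each of the columns `x` and `y`, and its image is confined. -/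
structure NearPMatrix (P : PartialField R) (f : R → 𝔽) (x y : Y) (M : Matrix X Y R) : Prop where
  ne : x ≠ y
  left : P.IsPMatrix (M.updateCol x 0)
  right : P.IsPMatrix (M.updateCol y 0)
  conf : CrossConfined (f '' P.fundamentalSet) (M.map f)

theorem NearPMatrix.apply_mem (h : NearPMatrix P f x y M) (i : X) (j : Y) : M i j ∈ P.elems :=
  apply_mem_of_updateCol h.ne h.left h.right i j

theorem NearPMatrix.symm (h : NearPMatrix P f x y M) : NearPMatrix P f y x M :=
  ⟨h.ne.symm, h.right, h.left, h.conf⟩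

theorem NearPMatrix.left_mem (h : NearPMatrix P f x y M) (i k : X) {z : Y} (hz : z ≠ y) :
    M i x * M k z - M i z * M k x ∈ P.elems := by
  simpa [Matrix.updateCol_apply, h.ne, hz] using h.right.two_mem i k x z

theorem NearPMatrix.pivot_of_ne_zero (hf : P.IsLiftable f) (h : NearPMatrix P f x y M) {a : X}
    {z : Y} (hx : z ≠ x) (hy : z ≠ y) (h0 : M a z ≠ 0) : NearPMatrix P f x y (pivot M a z) := by
  have h1 : P.IsPMatrix ((pivot M a z).updateCol x 0) := by
    rw [← pivot_updateCol_zero _ _ hx.symm]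
    exact isPMatrix_pivot h.left (by rwa [Matrix.updateCol_ne hx])
  have h2 : P.IsPMatrix ((pivot M a z).updateCol y 0) := by
    rw [← pivot_updateCol_zero _ _ hy.symm]
    exact isPMatrix_pivot h.right (by rwa [Matrix.updateCol_ne hy])
  refine ⟨h.ne, h1, h2, ?_⟩
  rw [hf.map_pivot h.apply_mem (apply_mem_of_updateCol h.ne h1 h2)]
  exact h.conf.reach (Reach.refl.pivot a z (hf.map_ne_zero (h.apply_mem _ _) h0))

/-- The form in which `IsLiftable.sub_mem_trans` is used: `t` is an intermediate term, `s` clears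
denominators, and confinement provides the condition on the image. -/
theorem NearPMatrix.good_of_trans (hf : P.IsLiftable f) (h : NearPMatrix P f x y M) {i k : X}
    (ha : M i x ≠ 0) (hb : M i y ≠ 0) (hc : M k x ≠ 0) (hd : M k y ≠ 0) {s t : R}
    (hs : s ∈ P.elems) (hs0 : s ≠ 0) (ht : t ∈ P.elems) (ht0 : t ≠ 0)
    (h1 : s * (M i x * M k y) - t ∈ P.elems) (h2 : t - s * (M i y * M k x) ∈ P.elems) :
    M i x * M k y - M i y * M k x ∈ P.elems := by
  have m := h.apply_mem
  have m1 := P.elems.mul_mem (m i x) (m k y)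
  have m2 := P.elems.mul_mem (m i y) (m k x)
  have n1 := hf.mul_ne_zero (m i x) (m k y) ha hd
  have n2 := hf.mul_ne_zero (m i y) (m k x) hb hc
  refine (mul_mem_elems_iff hs hs0).1 ?_
  rw [mul_sub]
  refine hf.sub_mem_trans (P.elems.mul_mem hs m1) (hf.mul_ne_zero hs m1 hs0 n1) ht ht0
    (P.elems.mul_mem hs m2) (hf.mul_ne_zero hs m2 hs0 n2) h1 h2 ?_
  have := h.conf _ .refl i k x y (hf.map_ne_zero (m _ _) ha) (hf.map_ne_zero (m _ _) hd)
    (hf.map_ne_zero (m _ _) hb) (hf.map_ne_zero (m _ _) hc)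
  simp only [Matrix.map_apply] at this
  rw [hf.map_mul _ hs _ m1, hf.map_mul _ hs _ m2, hf.map_mul _ (m _ _) _ (m _ _),
    hf.map_mul _ (m _ _) _ (m _ _), mul_div_mul_left _ _ (hf.map_ne_zero hs hs0)]
  exact this

/-- The cross ratio in columns `x`, `y` is the product of those in `x`, `z` and in `z`, `y`, and
each of the latter avoids one of the two critical columns. -/
theorem NearPMatrix.good_of_col (hf : P.IsLiftable f) (h : NearPMatrix P f x y M) {i k : X}
    (ha : M i x ≠ 0) (hb : M i y ≠ 0) (hc : M k x ≠ 0) (hd : M k y ≠ 0) {z : Y} (hx : z ≠ x)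
    (hy : z ≠ y) (hi : M i z ≠ 0) (hk : M k z ≠ 0) :
    M i x * M k y - M i y * M k x ∈ P.elems := by
  have m := h.apply_mem
  refine h.good_of_trans hf ha hb hc hd (P.elems.mul_mem (m i z) (m k z))
    (hf.mul_ne_zero (m _ _) (m _ _) hi hk)
    (P.elems.mul_mem (P.elems.mul_mem (m i z) (m k x)) (P.elems.mul_mem (m k y) (m i z)))
    (hf.mul_ne_zero (P.elems.mul_mem (m _ _) (m _ _)) (P.elems.mul_mem (m _ _) (m _ _))
      (hf.mul_ne_zero (m _ _) (m _ _) hi hc) (hf.mul_ne_zero (m _ _) (m _ _) hd hi)) ?_ ?_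
  · convert P.elems.mul_mem (P.elems.mul_mem (m k y) (m i z)) (h.left_mem i k hy) using 1
    ring
  · convert P.elems.mul_mem (P.elems.mul_mem (m i z) (m k x))
      (neg_mem_elems (h.symm.left_mem i k hx)) using 1
    ring

/-- The configuration in which the rows `i` and `k` are at distance two in the columns other
than `x` and `y`. -/
structure Hexagon (x y : Y) (M : Matrix X Y R) (i w k : X) (p q : Y) : Prop where
  px : p ≠ x
  py : p ≠ y
  qx : q ≠ x
  qy : q ≠ y
  ip : M i p ≠ 0
  wp : M w p ≠ 0
  wq : M w q ≠ 0
  kq : M k q ≠ 0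
  iq : M i q = 0
  kp : M k p = 0

omit [DecidableEq Y] in
theorem Hexagon.symm {i w k : X} {p q : Y} (h : Hexagon x y M i w k p q) :
    Hexagon x y M k w i q p := ⟨h.qx, h.qy, h.px, h.py, h.kq, h.wq, h.wp, h.ip, h.kp, h.iq⟩

omit [DecidableEq Y] in
theorem Hexagon.swap {i w k : X} {p q : Y} (h : Hexagon x y M i w k p q) :
    Hexagon y x M i w k p q := ⟨h.py, h.px, h.qy, h.qx, h.ip, h.wp, h.wq, h.kq, h.iq, h.kp⟩

/-- After a pivot on `(w, p)` the rows `i` and `k` share column `q`, so `NearPMatrix.good_of_col`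
applies unless the new entry at `(i, x)` vanishes, which is the stated equation. -/
theorem NearPMatrix.good_or_eq (hf : P.IsLiftable f) (h : NearPMatrix P f x y M) {i w k : X}
    (ha : M i x ≠ 0) (hb : M i y ≠ 0) (hc : M k x ≠ 0) (hd : M k y ≠ 0) {p q : Y}
    (H : Hexagon x y M i w k p q) (hwy : M w y = 0) :
    M i x * M k y - M i y * M k x ∈ P.elems ∨ M i x * M w p = M i p * M w x := by
  have m := h.apply_mem
  have hiw : i ≠ w := by rintro rfl; exact H.wq H.iq
  have hkw : k ≠ w := by rintro rfl; exact H.wp H.kp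
  have hqp : q ≠ p := by rintro rfl; exact H.ip H.iq
  have hN := h.pivot_of_ne_zero hf H.px H.py H.wp
  have e := Ring.inverse_mul_cancel _ (isUnit_of_mem_elems (m w p) H.wp)
  have mi := inverse_mem_elems (m w p)
  have ix : pivot M w p i x = M i x - M i p * Ring.inverse (M w p) * M w x :=
    pivot_apply _ hiw H.px.symm
  have iy : pivot M w p i y = M i y := by rw [pivot_apply _ hiw H.py.symm, hwy]; simp
  have kk : ∀ j, pivot M w p k j = M k j := pivot_row_eq hkw H.kp
  by_cases h0 : pivot M w p i x = 0
  · right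
    linear_combination M w p * (ix.symm.trans h0) + M i p * M w x * e
  · left
    have iq : pivot M w p i q ≠ 0 := by
      rw [pivot_apply _ hiw hqp, H.iq, zero_sub, neg_ne_zero]
      exact hf.mul_ne_zero (P.elems.mul_mem (m _ _) mi) (m _ _) (hf.mul_ne_zero (m _ _) mi H.ip
        (hf.inverse_ne_zero (m _ _) H.wp)) H.wq
    have key := hN.good_of_col hf (i := i) (k := k) h0 (by rwa [iy]) (by rwa [kk]) (by rwa [kk])
      H.qx H.qy iq (by rw [kk]; exact H.kq)
    rw [iy, kk, kk] at key
    refine h.good_of_trans hf ha hb hc hd P.elems.one_mem hf.one_ne_zero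
      (P.elems.mul_mem (hN.apply_mem i x) (m k y))
      (hf.mul_ne_zero (hN.apply_mem _ _) (m _ _) h0 hd) ?_ (by rwa [one_mul])
    convert P.elems.mul_mem (P.elems.mul_mem (P.elems.mul_mem (m i p) mi) (m w x)) (m k y) using 1
    rw [ix]
    ring

/-- `NearPMatrix.good_or_eq` is used three times: from `i`, from `k`, and after a pivot on `(i, p)`
that makes `w` vanish in column `x` instead of `y`. If all three fail, the three equations combine
to cross ratio `-1`, and the determinant is `-2` times a product of entries. -/
theorem NearPMatrix.good_of_hexagon (hf : P.IsLiftable f) (h : NearPMatrix P f x y M) {i w k : X}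
    (ha : M i x ≠ 0) (hb : M i y ≠ 0) (hc : M k x ≠ 0) (hd : M k y ≠ 0) {p q : Y}
    (H : Hexagon x y M i w k p q) (hwy : M w y = 0) :
    M i x * M k y - M i y * M k x ∈ P.elems := by
  have m := h.apply_mem
  rcases h.good_or_eq hf ha hb hc hd H hwy with h1 | h1
  · exact h1
  rcases h.good_or_eq hf hc hd ha hb H.symm hwy with h2 | h2
  · rw [sub_mem_elems_comm]
    convert h2 using 1
    ring
  have hiw : i ≠ w := by rintro rfl; exact H.wq H.iq
  have hki : k ≠ i := by rintro rfl; exact H.ip H.kp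
  have hqp : q ≠ p := by rintro rfl; exact H.ip H.iq
  have hN := h.pivot_of_ne_zero hf H.px H.py H.ip
  have e := Ring.inverse_mul_cancel _ (isUnit_of_mem_elems (m i p) H.ip)
  have mi := inverse_mem_elems (m i p)
  have mi0 := hf.inverse_ne_zero (m i p) H.ip
  have ix : pivot M i p i x = Ring.inverse (M i p) * M i x := pivot_apply_row _ _ H.px.symm
  have iy : pivot M i p i y = Ring.inverse (M i p) * M i y := pivot_apply_row _ _ H.py.symm
  have wx : pivot M i p w x = 0 := by
    rw [pivot_apply _ hiw.symm H.px.symm]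
    linear_combination -Ring.inverse (M i p) * h1 - M w x * e
  have wy : pivot M i p w y = -(M w p * Ring.inverse (M i p) * M i y) := by
    rw [pivot_apply _ hiw.symm H.py.symm, hwy, zero_sub]
  have wq : pivot M i p w q = M w q := by rw [pivot_apply _ hiw.symm hqp, H.iq]; simp
  have kk : ∀ j, pivot M i p k j = M k j := pivot_row_eq hki H.kp
  have HN : Hexagon y x (pivot M i p) k w i q p := by
    refine ⟨H.qy, H.qx, H.py, H.px, ?_, ?_, ?_, ?_, ?_, ?_⟩
    · rw [kk]; exact H.kq
    · rw [wq]; exact H.wq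
    · rw [pivot_apply_col _ hiw.symm, neg_ne_zero]
      exact hf.mul_ne_zero (m _ _) mi H.wp mi0
    · rwa [pivot_apply_self]
    · rw [kk]; exact H.kp
    · rw [pivot_apply_row _ _ hqp, H.iq, mul_zero]
  rcases hN.symm.good_or_eq hf (by rwa [kk]) (by rwa [kk])
    (by rw [iy]; exact hf.mul_ne_zero mi (m _ _) mi0 hb)
    (by rw [ix]; exact hf.mul_ne_zero mi (m _ _) mi0 ha) HN wx with h3 | h3
  · rw [kk, kk, ix, iy] at h3
    refine (mul_mem_elems_iff mi mi0).1 ?_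
    convert h3 using 1
    ring
  · rw [kk, kk, wq, wy] at h3
    have key : M i x * M k y = -(M i y * M k x) := by
      refine (((isUnit_of_mem_elems (m i p) H.ip).mul (isUnit_of_mem_elems (m w p) H.wp)).mul
        (isUnit_of_mem_elems (m w q) H.wq)).mul_left_cancel ?_
      linear_combination M k y * M w q * M i p * h1 + M i p * M i p * M w x * h3
        - M i p * M w x * M k q * M w p * M i y * e + M i p * M w p * M i y * h2
    have fa := hf.map_ne_zero (m i x) ha
    have fb := hf.map_ne_zero (m i y) hb
    have fc := hf.map_ne_zero (m k x) hc
    have fd := hf.map_ne_zero (m k y) hd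
    have hcr := h.conf _ .refl i k x y fa fd fb fc
    have h2 : (2 : R) ∈ P.elems := by
      refine hf.two_mem ?_
      convert hcr using 1
      simp only [Matrix.map_apply]
      rw [← hf.map_mul _ (m _ _) _ (m _ _), ← hf.map_mul _ (m _ _) _ (m _ _), key,
        hf.map_neg (P.elems.mul_mem (m _ _) (m _ _)), div_neg, div_self]
      rw [hf.map_mul _ (m _ _) _ (m _ _)]
      exact _root_.mul_ne_zero fb fc
    convert neg_mem_elems (P.elems.mul_mem h2 (P.elems.mul_mem (m i y) (m k x))) using 1
    rw [key]
    ring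

/-- Zero entries make the determinant a single product. Otherwise pivots fixing rows `i` and `k`
bring them to distance at most two. -/
theorem NearPMatrix.good_of_linked (hf : P.IsLiftable f) (h : NearPMatrix P f x y M) {i k : X}
    (hl : Linked (M.map f) {x, y} i k) : M i x * M k y - M i y * M k x ∈ P.elems := by
  have m := h.apply_mem
  by_cases ha : M i x = 0
  · rw [ha, zero_mul, zero_sub]
    exact neg_mem_elems (P.elems.mul_mem (m _ _) (m _ _))
  by_cases hd : M k y = 0
  · rw [hd, mul_zero, zero_sub]
    exact neg_mem_elems (P.elems.mul_mem (m _ _) (m _ _))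
  by_cases hb : M i y = 0
  · rw [hb, zero_mul, sub_zero]
    exact P.elems.mul_mem (m _ _) (m _ _)
  by_cases hc : M k x = 0
  · rw [hc, mul_zero, sub_zero]
    exact P.elems.mul_mem (m _ _) (m _ _)
  have : Nonempty Y := ⟨y⟩
  obtain ⟨n, s, z, hs, h0, hn⟩ := hl.exists_isChain
  obtain ⟨_, ⟨N, hN, rfl, hN1, hN2, hN3, hN4⟩, m', hm', s', z', hs', h0', hm''⟩ :=
    IsChain.exists_le_two (a := i) (b := k) (T := {x, y})
      (I := fun A => ∃ N, NearPMatrix P f x y N ∧ N.map f = A ∧ N i x = M i x ∧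
        N i y = M i y ∧ N k x = M k x ∧ N k y = M k y)
      (by
        rintro _ a w ⟨N, hN, rfl, h1, h2, h3, h4⟩ haw hw hiw hkw
        rw [Matrix.map_apply, hf.map_eq_zero_iff (hN.apply_mem _ _)] at hiw hkw
        rw [Matrix.map_apply, Ne, hf.map_eq_zero_iff (hN.apply_mem _ _)] at haw
        have hia : i ≠ a := by rintro rfl; exact haw hiw
        have hka : k ≠ a := by rintro rfl; exact haw hkw
        simp only [Set.mem_insert_iff, Set.mem_singleton_iff, not_or] at hw
        have hNp := hN.pivot_of_ne_zero hf hw.1 hw.2 haw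
        refine ⟨_, hNp, hf.map_pivot hN.apply_mem hNp.apply_mem, ?_, ?_, ?_, ?_⟩
        · rw [pivot_row_eq hia hiw, h1]
        · rw [pivot_row_eq hia hiw, h2]
        · rw [pivot_row_eq hka hkw, h3]
        · rw [pivot_row_eq hka hkw, h4])
      n ⟨M, h, rfl, rfl, rfl, rfl, rfl⟩ hs h0 hn
  rw [← hN1] at ha
  rw [← hN2] at hb
  rw [← hN3] at hc
  rw [← hN4] at hd
  rw [← hN1, ← hN2, ← hN3, ← hN4]
  have hz : ∀ i j, N.map f i j ≠ 0 → N i j ≠ 0 := fun i j hij h0 => hij (by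
    rw [Matrix.map_apply, h0, hf.map_zero])
  simp only [IsChain, Set.mem_insert_iff, Set.mem_singleton_iff, not_or] at hs'
  have mN := hN.apply_mem
  obtain rfl | rfl | rfl : m' = 0 ∨ m' = 1 ∨ m' = 2 := by omega
  · obtain rfl : i = k := h0'.symm.trans hm''
    rw [mul_comm, sub_self]
    exact zero_mem_elems
  · obtain ⟨⟨t0, t0'⟩, e0, e1⟩ := hs' 0 (by omega)
    rw [h0'] at e0
    rw [zero_add, hm''] at e1
    exact hN.good_of_col hf ha hb hc hd t0 t0' (hz _ _ e0) (hz _ _ e1)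
  · obtain ⟨⟨t0, t0'⟩, e0, e1⟩ := hs' 0 (by omega)
    obtain ⟨⟨t1, t1'⟩, e2, e3⟩ := hs' 1 (by omega)
    rw [h0'] at e0
    rw [show 1 + 1 = 2 from rfl, hm''] at e3
    rw [zero_add] at e1
    replace e0 := hz _ _ e0
    replace e1 := hz _ _ e1
    replace e2 := hz _ _ e2
    replace e3 := hz _ _ e3
    generalize s' 1 = w at *
    by_cases h1 : N i (z' 1) = 0
    swap
    · exact hN.good_of_col hf ha hb hc hd t1 t1' h1 e3
    by_cases h2 : N k (z' 0) = 0
    swap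
    · exact hN.good_of_col hf ha hb hc hd t0 t0' e0 h2
    have H : Hexagon x y N i w k (z' 0) (z' 1) := ⟨t0, t0', t1, t1', e0, e1, e2, e3, h1, h2⟩
    by_cases hwy : N w y = 0
    · exact hN.good_of_hexagon hf ha hb hc hd H hwy
    by_cases hwx : N w x = 0
    · rw [sub_mem_elems_comm]
      exact hN.symm.good_of_hexagon hf hb ha hd hc H.swap hwx
    -- With both entries of `w` nonzero, the cross ratio of `i`, `k` is the product of those of `i`,
    -- `w` and of `w`, `k`.
    · have q1 := hN.good_of_col hf ha hb hwx hwy t0 t0' e0 e1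
      have q2 := hN.good_of_col hf hwx hwy hc hd t1 t1' e2 e3
      refine hN.good_of_trans hf ha hb hc hd (P.elems.mul_mem (mN w x) (mN w y))
        (hf.mul_ne_zero (mN _ _) (mN _ _) hwx hwy)
        (P.elems.mul_mem (P.elems.mul_mem (mN i y) (mN w x)) (P.elems.mul_mem (mN w x) (mN k y)))
        (hf.mul_ne_zero (P.elems.mul_mem (mN _ _) (mN _ _)) (P.elems.mul_mem (mN _ _) (mN _ _))
          (hf.mul_ne_zero (mN _ _) (mN _ _) hb hwx) (hf.mul_ne_zero (mN _ _) (mN _ _) hwx hd)) ?_ ?_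
      · convert P.elems.mul_mem (P.elems.mul_mem (mN w x) (mN k y)) q1 using 1
        ring
      · convert P.elems.mul_mem (P.elems.mul_mem (mN i y) (mN w x)) q2 using 1
        ring

/-- All rows meeting the columns `x` and `y` lie in one component of the remaining columns. -/
def ColumnsLinked {𝔽 : Type*} [Field 𝔽] (A : Matrix X Y 𝔽) (x y : Y) : Prop :=
  ∀ i k, (A i x ≠ 0 ∨ A i y ≠ 0) → (A k x ≠ 0 ∨ A k y ≠ 0) → Linked A {x, y} i k

omit [DecidableEq Y] in
theorem ColumnsLinked.pivot_of_ne_zero {A : Matrix X Y 𝔽} (h : ColumnsLinked A x y) {a : X} {z : Y}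
    (hx : z ≠ x) (hy : z ≠ y) (h0 : A a z ≠ 0) : ColumnsLinked (pivot A a z) x y := by
  have hz : z ∉ ({x, y} : Set Y) := by simp [hx, hy]
  have key : ∀ i, (pivot A a z i x ≠ 0 ∨ pivot A a z i y ≠ 0) →
      ∃ k, (A k x ≠ 0 ∨ A k y ≠ 0) ∧ Linked A {x, y} i k := by
    intro i hi
    by_cases hia : i = a
    · subst hia
      refine ⟨i, ?_, .refl i⟩
      rw [pivot_apply_row _ _ hx.symm, pivot_apply_row _ _ hy.symm] at hi
      exact hi.imp right_ne_zero_of_mul right_ne_zero_of_mul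
    · by_cases hiz : A i z = 0
      · rw [pivot_row_eq hia hiz, pivot_row_eq hia hiz] at hi
        exact ⟨i, hi, .refl i⟩
      · by_cases hi' : A i x ≠ 0 ∨ A i y ≠ 0
        · exact ⟨i, hi', .refl i⟩
        · push Not at hi'
          rw [pivot_apply _ hia hx.symm, pivot_apply _ hia hy.symm, hi'.1, hi'.2, zero_sub,
            zero_sub, neg_ne_zero, neg_ne_zero] at hi
          exact ⟨a, hi.imp right_ne_zero_of_mul right_ne_zero_of_mul, linked_of_ne_zero hz hiz h0⟩
  intro i k hi hk
  obtain ⟨i', hi', hii⟩ := key i hi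
  obtain ⟨k', hk', hkk⟩ := key k hk
  exact (hii.trans ((h i' k' hi' hk').trans hkk.symm)).pivot hz h0

theorem NearPMatrix.isPMatrix (hf : P.IsLiftable f) (h : NearPMatrix P f x y M)
    (hl : ColumnsLinked (M.map f) x y) : P.IsPMatrix M := by
  refine isPMatrix_of_two_columns h.ne
    (I := fun M => NearPMatrix P f x y M ∧ ColumnsLinked (M.map f) x y)
    (fun M hM => hM.1.left) (fun M hM => hM.1.right) ?_ ?_ ⟨h, hl⟩
  · rintro M a z ⟨hM, hM'⟩ h0 hx hy
    have hN := hM.pivot_of_ne_zero hf hx hy h0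
    refine ⟨hN, ?_⟩
    rw [hf.map_pivot hM.apply_mem hN.apply_mem]
    exact hM'.pivot_of_ne_zero hx hy (hf.map_ne_zero (hM.apply_mem _ _) h0)
  · rintro M i k ⟨hM, hM'⟩
    have m := hM.apply_mem
    by_cases hi : M i x ≠ 0 ∨ M i y ≠ 0
    · by_cases hk : M k x ≠ 0 ∨ M k y ≠ 0
      · exact hM.good_of_linked hf (hM' i k
          (hi.imp (hf.map_ne_zero (m _ _)) (hf.map_ne_zero (m _ _)))
          (hk.imp (hf.map_ne_zero (m _ _)) (hf.map_ne_zero (m _ _))))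
      · push Not at hk
        rw [hk.1, hk.2]
        simpa using zero_mem_elems
    · push Not at hi
      rw [hi.1, hi.2]
      simpa using zero_mem_elems

end TwoColumns

/-! ### Constructing lifts: pivots, short columns, gluing, 2 × 2 summands. -/

section HasLift

variable {R : Type w} [CommRing R] {P : PartialField R} {𝔽 : Type*} [Field 𝔽] {f : R → 𝔽}
  {X : Type u} {Y : Type v}

/-- Up to scaling, `A` is the image of a `P`-matrix. -/
def HasLift (P : PartialField R) (f : R → 𝔽) (A : Matrix X Y 𝔽) : Prop :=
  ∃ M : Matrix X Y R, P.IsPMatrix M ∧ ∃ (r : X → 𝔽) (c : Y → 𝔽), (∀ i, r i ≠ 0) ∧ (∀ j, c j ≠ 0) ∧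
    ∀ i j, f (M i j) = r i * A i j * c j

variable {A : Matrix X Y 𝔽}

theorem HasLift.transpose (h : HasLift P f A) : HasLift P f A.transpose := by
  obtain ⟨M, hM, r, c, hr, hc, h⟩ := h
  exact ⟨M.transpose, hM.transpose, c, r, hc, hr, fun i j => by
    simp only [Matrix.transpose_apply, h]; ring⟩

theorem pivot_pivot {x : X} {y : Y} (h : A x y ≠ 0) : pivot (pivot A x y) x y = A := by
  ext i j
  by_cases hi : i = x <;> by_cases hj : j = y <;> simp [pivot, hi, hj] <;> field_simp
  ring

theorem HasLift.pivot (hf : P.IsLiftable f) (h : HasLift P f A) {x : X} {y : Y}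
    (hxy : A x y ≠ 0) : HasLift P f (pivot A x y) := by
  classical
  obtain ⟨M, hM, r, c, hr, hc, h⟩ := h
  have h0 : M x y ≠ 0 := fun h0 => by
    have := h x y
    rw [h0, hf.map_zero] at this
    exact mul_ne_zero (mul_ne_zero (hr x) hxy) (hc y) this.symm
  have hN := isPMatrix_pivot hM h0
  refine ⟨_, hN, fun i => if i = x then (c y)⁻¹ else r i, fun j => if j = y then (r x)⁻¹ else c j,
    fun i => ?_, fun j => ?_, fun i j => ?_⟩
  · dsimp only
    split_ifs
    exacts [inv_ne_zero (hc y), hr i]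
  · dsimp only
    split_ifs
    exacts [inv_ne_zero (hr x), hc j]
  · have e := congrFun (congrFun (hf.map_pivot hM.apply_mem hN.apply_mem) i) j
    rw [Matrix.map_apply] at e
    rw [e]
    have := hr x
    have := hc y
    by_cases hi : i = x <;> by_cases hj : j = y <;>
      simp [PartialField.pivot, hi, hj, h] <;> field_simp

theorem HasLift.of_pivot (hf : P.IsLiftable f) {x : X} {y : Y} (hxy : A x y ≠ 0)
    (h : HasLift P f (PartialField.pivot A x y)) : HasLift P f A := by
  rw [← pivot_pivot hxy]
  exact h.pivot hf (by rw [pivot_apply_self]; simpa using hxy)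

theorem HasLift.of_col_le_one [DecidableEq Y] (hf : P.IsLiftable f) {y : Y} {x : X}
    (h0 : ∀ i, i ≠ x → A i y = 0) (h : HasLift P f (A.updateCol y 0)) : HasLift P f A := by
  classical
  by_cases hxy : A x y = 0
  · have : A.updateCol y 0 = A := by
      ext i j
      by_cases hj : j = y
      · subst hj
        by_cases hi : i = x
        · simp [hi, hxy]
        · simp [h0 i hi]
      · simp [hj]
    rwa [this] at h
  obtain ⟨M, hM, r, c, hr, hc, h⟩ := h
  refine ⟨M.updateCol y (Pi.single x 1), ?_, r,
    fun j => if j = y then (r x * A x y)⁻¹ else c j, hr, fun j => ?_, fun i j => ?_⟩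
  · refine isPMatrix_of_updateCol_of_col (y := y) (x := x) ?_ ?_ ?_
    · rw [Matrix.updateCol_idem]
      exact hM.updateCol_zero y
    · simp
    · intro i hi
      simp [hi]
  · dsimp only
    split_ifs
    exacts [inv_ne_zero (mul_ne_zero (hr x) hxy), hc j]
  · by_cases hj : j = y
    · subst hj
      by_cases hi : i = x
      · subst hi
        have := hr i
        simp [hf.map_one]
        field_simp
      · simp [hi, hf.map_zero, h0 i hi]
    · have := h i j
      simpa [hj] using this

theorem Linked.congr {A B : Matrix X Y 𝔽} {T : Set Y} {i k : X} (h : Linked A T i k)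
    (hAB : ∀ i j, B i j ≠ 0 ↔ A i j ≠ 0) : Linked B T i k :=
  fun S U hS => h S U fun a b hb hab => hS a b hb ((hAB a b).2 hab)

theorem ColumnsLinked.congr {A B : Matrix X Y 𝔽} {x y : Y} (h : ColumnsLinked A x y)
    (hAB : ∀ i j, B i j ≠ 0 ↔ A i j ≠ 0) : ColumnsLinked B x y := by
  intro i k hi hk
  rw [hAB, hAB] at hi hk
  exact (h i k hi hk).congr hAB

/-- Gluing lifts of `A` with one of two linked columns removed. -/
theorem HasLift.glue [DecidableEq Y] [Finite Y] (hf : P.IsLiftable f) {x y : Y} (hxy : x ≠ y)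
    (hA : CrossConfined (f '' P.fundamentalSet) A) (hl : ColumnsLinked A x y)
    (hx : HasLift P f (A.updateCol x 0)) (hy : HasLift P f (A.updateCol y 0)) :
    HasLift P f A := by
  classical
  have := Fintype.ofFinite Y
  obtain ⟨M₁, hM₁, r₁, c₁, hr₁, hc₁, h₁⟩ := hx
  obtain ⟨M₂, hM₂, r₂, c₂, hr₂, hc₂, h₂⟩ := hy
  have h₁' : ∀ i j, j ≠ x → f (M₁ i j) = r₁ i * A i j * c₁ j := fun i j hj => by
    rw [h₁, Matrix.updateCol_ne hj]
  have h₂' : ∀ i j, j ≠ y → f (M₂ i j) = r₂ i * A i j * c₂ j := fun i j hj => by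
    rw [h₂, Matrix.updateCol_ne hj]
  obtain ⟨ρ, κ, hρ, hκ, hS⟩ := hf.exists_scaling (hM₂.updateCol_zero x) (hM₁.updateCol_zero y)
    (r := fun i => r₁ i / r₂ i) (c := fun j => c₁ j / c₂ j)
    (fun i => div_ne_zero (hr₁ i) (hr₂ i)) (fun j => div_ne_zero (hc₁ j) (hc₂ j)) (by
      intro i j
      have := hr₂ i
      have := hc₂ j
      by_cases hjx : j = x
      · subst hjx
        simp [hxy, hf.map_zero, h₁]
      by_cases hjy : j = y
      · subst hjy
        simp [hxy.symm, hf.map_zero, h₂]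
      rw [Matrix.updateCol_ne hjx, Matrix.updateCol_ne hjy, h₁' i j hjx, h₂' i j hjy]
      field_simp) Finset.univ
  have fρ : ∀ i, f (ρ i) ≠ 0 := fun i => hf.map_ne_zero (hρ i).1 (hρ i).2
  have fκ : ∀ j, f (κ j) ≠ 0 := fun j => hf.map_ne_zero (hκ j).1 (hκ j).2
  have hS' : ∀ i j, j ≠ x → j ≠ y → M₁ i j = ρ i * M₂ i j * κ j := fun i j hjx hjy => by
    have := hS i j (Finset.mem_univ j)
    rwa [Matrix.updateCol_ne hjx, Matrix.updateCol_ne hjy] at this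
  have fm : ∀ i j, f (ρ i * M₂ i j * κ j) = f (ρ i) * f (M₂ i j) * f (κ j) := fun i j => by
    rw [hf.map_mul _ (P.elems.mul_mem (hρ i).1 (hM₂.apply_mem _ _)) _ (hκ j).1,
      hf.map_mul _ (hρ i).1 _ (hM₂.apply_mem _ _)]
  -- The row scalings of the two lifts could differ between components. The rows meeting column `x`
  -- lie in one component, so there a single factor `t` suffices, and it is absorbed into the
  -- scaling of column `x`.
  obtain ⟨t, ht0, ht⟩ : ∃ t : 𝔽, t ≠ 0 ∧ ∀ i, A i x ≠ 0 → r₂ i * f (ρ i) / r₁ i = t := by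
    by_cases h : ∃ k, A k x ≠ 0
    · obtain ⟨k, hk⟩ := h
      refine ⟨r₂ k * f (ρ k) / r₁ k, div_ne_zero (mul_ne_zero (hr₂ k) (fρ k)) (hr₁ k),
        fun i hi => ?_⟩
      refine (hl i k (Or.inl hi) (Or.inl hk)).label_eq (r := fun i => r₂ i * f (ρ i) / r₁ i)
        (c := fun j => c₁ j / (c₂ j * f (κ j))) fun a b hb hab => ?_
      simp only [Set.mem_insert_iff, Set.mem_singleton_iff, not_or] at hb
      have e := h₁' a b hb.1
      rw [hS' a b hb.1 hb.2, fm, h₂' a b hb.2] at e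
      rw [div_eq_div_iff (hr₁ a) (mul_ne_zero (hc₂ b) (fκ b))]
      apply mul_right_cancel₀ hab
      linear_combination e
    · push Not at h
      exact ⟨1, one_ne_zero, fun i hi => absurd (h i) hi⟩
  let M : Matrix X Y R := M₁.updateCol x (fun i => ρ i * M₂ i x * κ x)
  have hMx : P.IsPMatrix (M.updateCol x 0) := by
    simp only [M, Matrix.updateCol_idem]
    exact hM₁.updateCol_zero x
  have hMy : P.IsPMatrix (M.updateCol y 0) := by
    have := (hM₂.scale (fun i => (hρ i).1) (fun j => (hκ j).1)).updateCol_zero y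
    convert this using 1
    ext i j
    by_cases hjy : j = y
    · subst hjy; simp
    · by_cases hjx : j = x
      · subst hjx; simp [M, hjy]
      · simp [M, hjy, hjx, hS' i j hjx hjy]
  have hfM : ∀ i j, f (M i j) = r₁ i * A i j * (if j = x then t * c₂ x * f (κ x) else c₁ j) := by
    intro i j
    by_cases hjx : j = x
    · subst hjx
      simp only [M, Matrix.updateCol_self, if_true]
      rw [fm, h₂' i j hxy]
      by_cases h0 : A i j = 0
      · simp [h0]
      · rw [← ht i h0]
        have := hr₁ i
        field_simp
    · simp only [M, Matrix.updateCol_ne hjx, if_neg hjx]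
      exact h₁' i j hjx
  have hc : ∀ j, (if j = x then t * c₂ x * f (κ x) else c₁ j) ≠ 0 := fun j => by
    split_ifs
    exacts [mul_ne_zero (mul_ne_zero ht0 (hc₂ x)) (fκ x), hc₁ j]
  refine ⟨M, ?_, r₁, _, hr₁, hc, hfM⟩
  have hN : NearPMatrix P f x y M := by
    refine ⟨hxy, hMx, hMy, ?_⟩
    have := hA.reach (Reach.refl.scale r₁ _ hr₁ hc)
    convert this using 1
    ext i j
    simp [hfM]
  refine hN.isPMatrix hf (hl.congr fun i j => ?_)
  rw [Matrix.map_apply, hfM, mul_ne_zero_iff, mul_ne_zero_iff]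
  exact ⟨fun h => h.1.2, fun h => ⟨⟨hr₁ i, h⟩, hc j⟩⟩

/-- Lifting a matrix with a `2 × 2` block as a direct summand. -/
theorem HasLift.of_block [DecidableEq Y] (hf : P.IsLiftable f) {x y : Y} (hxy : x ≠ y) {i k : X}
    (hik : i ≠ k) (hA : CrossConfined (f '' P.fundamentalSet) A) (hix : A i x ≠ 0)
    (hiy : A i y ≠ 0) (hkx : A k x ≠ 0) (hky : A k y ≠ 0)
    (hrow : ∀ j, j ≠ x → j ≠ y → A i j = 0 ∧ A k j = 0)
    (hcol : ∀ a, a ≠ i → a ≠ k → A a x = 0 ∧ A a y = 0) (h : HasLift P f (A.updateCol x 0)) :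
    HasLift P f A := by
  classical
  obtain ⟨M₁, hM₁, r, c, hr, hc, h⟩ := h
  have h' : ∀ i j, j ≠ x → f (M₁ i j) = r i * A i j * c j := fun i j hj => by
    rw [h, Matrix.updateCol_ne hj]
  obtain ⟨p, hp, hpe⟩ := hA _ .refl i k x y hix hky hiy hkx
  have hzero : ∀ a b, b ≠ x → A a b = 0 → M₁ a b = 0 := fun a b hb h0 => by
    rw [← hf.map_eq_zero_iff (hM₁.apply_mem _ _), h' a b hb, h0]; ring
  have m := hM₁.apply_mem
  -- Column `x` is a copy of column `y` with row `k` multiplied by the lift `p` of the cross ratio,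
  -- so the determinant of the block is a product of entries times `1 - p`.
  let M : Matrix X Y R := M₁.updateCol x (fun a => if a = k then p * M₁ k y else M₁ a y)
  have Mx : ∀ a, a ≠ k → M a x = M₁ a y := fun a ha => by simp [M, ha]
  have Mkx : M k x = p * M₁ k y := by simp [M]
  have Mj : ∀ a j, j ≠ x → M a j = M₁ a j := fun a j hj => by simp [M, hj]
  refine ⟨M, ?_, r, fun j => if j = x then c y * A i y / A i x else c j, hr, fun j => ?_,
    fun a j => ?_⟩
  · refine isPMatrix_of_two_columns hxy (I := fun N => P.IsPMatrix (N.updateCol x 0) ∧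
      P.IsPMatrix (N.updateCol y 0) ∧ (∀ j, j ≠ x → j ≠ y → N i j = 0 ∧ N k j = 0) ∧
      (∀ a, a ≠ i → a ≠ k → N a x = 0 ∧ N a y = 0) ∧ N i x * N k y - N i y * N k x ∈ P.elems)
      (fun N hN => hN.1) (fun N hN => hN.2.1) ?_ ?_ ?_
    · rintro N a z ⟨h1, h2, h3, h4, h5⟩ h0 hzx hzy
      have hai : i ≠ a := by rintro rfl; exact h0 (h3 z hzx hzy).1
      have hak : k ≠ a := by rintro rfl; exact h0 (h3 z hzx hzy).2
      have ei := pivot_row_eq hai (h3 z hzx hzy).1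
      have ek := pivot_row_eq hak (h3 z hzx hzy).2
      refine ⟨?_, ?_, ?_, ?_, ?_⟩
      · rw [← pivot_updateCol_zero _ _ hzx.symm]
        exact isPMatrix_pivot h1 (by rwa [Matrix.updateCol_ne hzx])
      · rw [← pivot_updateCol_zero _ _ hzy.symm]
        exact isPMatrix_pivot h2 (by rwa [Matrix.updateCol_ne hzy])
      · intro j hjx hjy
        rw [ei, ek]
        exact h3 j hjx hjy
      · intro b hbi hbk
        have ha := h4 a hai.symm hak.symm
        have hb := h4 b hbi hbk
        by_cases hba : b = a
        · subst hba
          rw [pivot_apply_row _ _ hzx.symm, pivot_apply_row _ _ hzy.symm, ha.1, ha.2]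
          simp
        · rw [pivot_apply _ hba hzx.symm, pivot_apply _ hba hzy.symm, ha.1, ha.2, hb.1, hb.2]
          simp
      · rwa [ei, ei, ek, ek]
    · rintro N a b ⟨-, -, -, h4, h5⟩
      by_cases ha : a ≠ i ∧ a ≠ k
      · rw [(h4 a ha.1 ha.2).1, (h4 a ha.1 ha.2).2]
        simpa using zero_mem_elems
      by_cases hb : b ≠ i ∧ b ≠ k
      · rw [(h4 b hb.1 hb.2).1, (h4 b hb.1 hb.2).2]
        simpa using zero_mem_elems
      have ha' : a = i ∨ a = k := by tauto
      have hb' : b = i ∨ b = k := by tauto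
      rcases ha' with rfl | rfl <;> rcases hb' with rfl | rfl
      · rw [mul_comm, sub_self]; exact zero_mem_elems
      · exact h5
      · rw [sub_mem_elems_comm]
        convert h5 using 1
        ring
      · rw [mul_comm, sub_self]; exact zero_mem_elems
    · refine ⟨?_, ?_, ?_, ?_, ?_⟩
      · simp only [M, Matrix.updateCol_idem]
        exact hM₁.updateCol_zero x
      -- Without column `y`, `M` is `M₁` with columns `x` and `y` exchanged and row `k` scaled by
      -- `p`; the scaling does no other harm because row `k` vanishes off the block.
      · have := ((hM₁.updateCol_zero x).submatrix id (Equiv.swap x y)).scale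
          (r := fun a => if a = k then p else 1) (c := fun _ => 1)
          (fun a => by split_ifs; exacts [hp.1, P.elems.one_mem]) (fun _ => P.elems.one_mem)
        convert this using 1
        ext a j
        by_cases hjy : j = y
        · subst hjy
          simp
        · by_cases hjx : j = x
          · subst hjx
            by_cases ha : a = k
            · subst ha; simp [hxy, Mkx, Matrix.updateCol_apply, hxy.symm]
            · simp [hxy, Mx a ha, Matrix.updateCol_apply, hxy.symm, ha]
          · rw [Matrix.updateCol_ne hjy, Mj a j hjx]
            by_cases ha : a = k
            · subst ha
              simp [Equiv.swap_apply_of_ne_of_ne hjx hjy, hjx, hzero a j hjx (hrow j hjx hjy).2]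
            · simp [Equiv.swap_apply_of_ne_of_ne hjx hjy, hjx, ha]
      · intro j hjx hjy
        rw [Mj _ _ hjx, Mj _ _ hjx]
        exact ⟨hzero i j hjx (hrow j hjx hjy).1, hzero k j hjx (hrow j hjx hjy).2⟩
      · intro a hai hak
        rw [Mx a hak, Mj a y hxy.symm]
        have := hzero a y hxy.symm (hcol a hai hak).2
        exact ⟨this, this⟩
      · rw [Mx i hik, Mkx, Mj _ _ hxy.symm, Mj _ _ hxy.symm]
        convert P.elems.mul_mem (P.elems.mul_mem (m i y) (m k y)) hp.2 using 1
        ring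
  · dsimp only
    split_ifs
    exacts [div_ne_zero (mul_ne_zero (hc y) hiy) hix, hc j]
  · by_cases hj : j = x
    · subst hj
      simp only [if_true]
      by_cases ha : a = k
      · subst ha
        rw [Mkx, hf.map_mul _ hp.1 _ (m _ _), hpe, h' a y hxy.symm]
        field_simp
      · rw [Mx a ha, h' a y hxy.symm]
        by_cases hai : a = i
        · subst hai
          field_simp
        · rw [(hcol a hai ha).1, (hcol a hai ha).2]
          ring
    · simp only [if_neg hj]
      rw [Mj a j hj, h' a j hj]

end HasLift

/-! ### Leaves of breadth-first spanning trees in the support graph. -/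

section Leaves

theorem exists_parent {V : Type*} (G : SimpleGraph V) (w : V) : ∃ p : V → V, ∀ v,
    G.Reachable w v → v ≠ w → G.Adj v (p v) ∧ G.dist w v = G.dist w (p v) + 1 := by
  have : ∀ v, ∃ u, G.Reachable w v → v ≠ w → G.Adj v u ∧ G.dist w v = G.dist w u + 1 := by
    intro v
    by_cases h : G.Reachable w v ∧ v ≠ w
    · obtain ⟨h, hne⟩ := h
      obtain ⟨q, hq⟩ := h.symm.exists_walk_length_eq_dist
      cases q with
      | nil => exact absurd rfl hne
      | @cons _ u _ ha q =>
        refine ⟨u, fun _ _ => ⟨ha, ?_⟩⟩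
        rw [SimpleGraph.Walk.length_cons] at hq
        obtain ⟨q', hq'⟩ := q.reachable.exists_walk_length_eq_dist
        have h1 := SimpleGraph.dist_le q
        have h2 := SimpleGraph.dist_le (SimpleGraph.Walk.cons ha q')
        rw [SimpleGraph.Walk.length_cons] at h2
        rw [G.dist_comm (u := w), G.dist_comm (u := w)]
        omega
    · exact ⟨v, fun h1 h2 => absurd ⟨h1, h2⟩ h⟩
  choose p hp using this
  exact ⟨p, hp⟩

/-- A vertex `w` with three neighbours lies in a spanning tree of its component with three leaves
other than `w`: removing some of these leaves leaves the rest of the component connected. -/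
theorem exists_leaves {V : Type*} [Finite V] (G : SimpleGraph V) (w : V) {n : Fin 3 → V}
    (hn : Function.Injective n) (hw : ∀ i, G.Adj w (n i)) :
    ∃ l : Fin 3 → V, Function.Injective l ∧ (∀ i, ∃ u, G.Adj (l i) u) ∧
      (∀ i, G.Reachable w (l i)) ∧ ∀ D ⊆ Set.range l, ∀ S : Set V,
        (∀ a b, a ∉ D → b ∉ D → G.Adj a b → (a ∈ S ↔ b ∈ S)) →
        ∀ v, G.Reachable w v → v ∉ D → (v ∈ S ↔ w ∈ S) := by
  obtain ⟨p, hp⟩ := exists_parent G w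
  have key : ∀ i, ∃ l, (G.Reachable w l ∧ l ≠ w ∧ p^[G.dist w l - 1] l = n i) ∧
      ∀ v, G.Reachable w v → v ≠ w → p v ≠ l := by
    intro i
    -- The branch of the breadth-first tree through the neighbour `n i`. A vertex of it farthest
    -- from `w` is a leaf, and different branches give different leaves.
    let D : Set V := {v | G.Reachable w v ∧ v ≠ w ∧ p^[G.dist w v - 1] v = n i}
    have hD : n i ∈ D := ⟨(hw i).reachable, (hw i).ne', by
      rw [SimpleGraph.dist_eq_one_iff_adj.2 (hw i)]; rfl⟩
    obtain ⟨l, hl, hmax⟩ := Set.exists_max_image D (G.dist w) D.toFinite ⟨_, hD⟩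
    refine ⟨l, hl, fun v hv hvw hpv => ?_⟩
    have hd := (hp v hv hvw).2
    rw [hpv] at hd
    have hpos := hl.1.pos_dist_of_ne hl.2.1.symm
    have hvD : v ∈ D := by
      refine ⟨hv, hvw, ?_⟩
      have : G.dist w v - 1 = (G.dist w l - 1) + 1 := by omega
      rw [this, Function.iterate_succ_apply, hpv]
      exact hl.2.2
    have := hmax v hvD
    omega
  choose l hl hleaf using key
  refine ⟨l, fun i j hij => hn ?_, fun i => ⟨_, (hp _ (hl i).1 (hl i).2.1).1⟩, fun i => (hl i).1,
    fun D hD S hS => ?_⟩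
  · rw [← (hl i).2.2, ← (hl j).2.2, hij]
  · have : ∀ d v, G.dist w v = d → G.Reachable w v → v ∉ D → (v ∈ S ↔ w ∈ S) := by
      intro d
      induction d with
      | zero =>
        intro v hd hv _
        rw [hv.dist_eq_zero_iff.1 hd]
      | succ d ih =>
        intro v hd hv hvD
        have hvw : v ≠ w := by
          rintro rfl
          simp at hd
        obtain ⟨h1, h2⟩ := hp v hv hvw
        have hpD : p v ∉ D := fun h => by
          obtain ⟨i, hi⟩ := hD h
          exact hleaf i v hv hvw hi.symm
        exact (hS _ _ hvD hpD h1).trans (ih (p v) (by omega) (hv.trans h1.reachable) hpD)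
    exact fun v hv hvD => this _ v rfl hv hvD

variable {𝔽 : Type*} [Field 𝔽] {X : Type u} {Y : Type v}

/-- The bipartite graph of the nonzero entries of a matrix. -/
def supportGraph (A : Matrix X Y 𝔽) : SimpleGraph (X ⊕ Y) where
  Adj a b := (∃ i j, a = Sum.inl i ∧ b = Sum.inr j ∧ A i j ≠ 0) ∨
    ∃ i j, b = Sum.inl i ∧ a = Sum.inr j ∧ A i j ≠ 0
  symm := ⟨fun _ _ h => h.symm⟩
  loopless := ⟨by rintro a (⟨i, j, rfl, h, -⟩ | ⟨i, j, rfl, h, -⟩) <;> cases h⟩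

theorem supportGraph_adj {A : Matrix X Y 𝔽} {i : X} {j : Y} (h : A i j ≠ 0) :
    (supportGraph A).Adj (Sum.inl i) (Sum.inr j) := Or.inl ⟨i, j, rfl, rfl, h⟩

/-- If some column has at least three nonzero entries, then there are two linked columns or two
linked rows. -/
theorem exists_columnsLinked [Finite X] [Finite Y] {A : Matrix X Y 𝔽} {z : Y} {n : Fin 3 → X}
    (hn : Function.Injective n) (hz : ∀ i, A (n i) z ≠ 0) :
    (∃ x y, x ≠ y ∧ (∃ i, A i x ≠ 0) ∧ (∃ i, A i y ≠ 0) ∧ ColumnsLinked A x y) ∨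
    (∃ x y, x ≠ y ∧ (∃ j, A x j ≠ 0) ∧ (∃ j, A y j ≠ 0) ∧ ColumnsLinked A.transpose x y) := by
  obtain ⟨l, hl, hne, hr, hD⟩ := exists_leaves (supportGraph A) (Sum.inr z)
    (n := fun i => Sum.inl (n i)) (fun i j h => hn (Sum.inl_injective h))
    (fun i => (supportGraph_adj (hz i)).symm)
  -- Of three leaves, two are both rows or both columns.
  obtain ⟨i, j, hij, he⟩ := Fintype.exists_ne_map_eq_of_card_lt (fun i => (l i).isLeft) (by simp)
  have hsub : ({l i, l j} : Set (X ⊕ Y)) ⊆ Set.range l := by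
    rintro a (rfl | rfl)
    exacts [⟨_, rfl⟩, ⟨_, rfl⟩]
  have hD' := hD _ hsub
  have hne1 := hne i
  have hne2 := hne j
  have hr1 := hr i
  have hr2 := hr j
  have hlij : l i ≠ l j := fun h => hij (hl h)
  generalize l i = a at *
  generalize l j = b at *
  rcases a with x | x <;> rcases b with y | y
  · right
    refine ⟨x, y, fun h => hlij (by rw [h]), ?_, ?_, fun a b ha hb S U hS => ?_⟩
    · obtain ⟨u, ⟨i, j, h1, h2, h3⟩ | ⟨i, j, h1, h2, h3⟩⟩ := hne1
      · cases h1; exact ⟨j, h3⟩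
      · cases h2
    · obtain ⟨u, ⟨i, j, h1, h2, h3⟩ | ⟨i, j, h1, h2, h3⟩⟩ := hne2
      · cases h1; exact ⟨j, h3⟩
      · cases h2
    · have h := hD' {s | Sum.elim (· ∈ U) (· ∈ S) s} (by
        rintro s t hs ht (⟨i, j, rfl, rfl, h⟩ | ⟨i, j, rfl, rfl, h⟩)
        · simp only [Set.mem_insert_iff, Sum.inl.injEq, Set.mem_singleton_iff] at hs
          exact (hS j i hs h).symm
        · simp only [Set.mem_insert_iff, Sum.inl.injEq, Set.mem_singleton_iff] at ht
          exact hS j i ht h)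
      have hc : ∀ c, (A x c ≠ 0 ∨ A y c ≠ 0) → (supportGraph A).Reachable (Sum.inr z)
          (Sum.inr c) := fun c hc => hc.elim
        (fun h => hr1.trans (supportGraph_adj h).reachable)
        (fun h => hr2.trans (supportGraph_adj h).reachable)
      exact (h _ (hc a ha) (by simp)).trans (h _ (hc b hb) (by simp)).symm
  · simp at he
  · simp at he
  · left
    refine ⟨x, y, fun h => hlij (by rw [h]), ?_, ?_, fun a b ha hb S U hS => ?_⟩
    · obtain ⟨u, ⟨i, j, h1, h2, h3⟩ | ⟨i, j, h1, h2, h3⟩⟩ := hne1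
      · cases h1
      · cases h2; exact ⟨i, h3⟩
    · obtain ⟨u, ⟨i, j, h1, h2, h3⟩ | ⟨i, j, h1, h2, h3⟩⟩ := hne2
      · cases h1
      · cases h2; exact ⟨i, h3⟩
    · have h := hD' {s | Sum.elim (· ∈ S) (· ∈ U) s} (by
        rintro s t hs ht (⟨i, j, rfl, rfl, h⟩ | ⟨i, j, rfl, rfl, h⟩)
        · simp only [Set.mem_insert_iff, Sum.inr.injEq, Set.mem_singleton_iff] at ht
          exact hS i j ht h
        · simp only [Set.mem_insert_iff, Sum.inr.injEq, Set.mem_singleton_iff] at hs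
          exact (hS i j hs h).symm)
      have hc : ∀ c, (A c x ≠ 0 ∨ A c y ≠ 0) → (supportGraph A).Reachable (Sum.inr z)
          (Sum.inl c) := fun c hc => hc.elim
        (fun h => hr1.trans (supportGraph_adj h).symm.reachable)
        (fun h => hr2.trans (supportGraph_adj h).symm.reachable)
      exact (h _ (hc a ha) (by simp)).trans (h _ (hc b hb) (by simp)).symm

end Leaves

/-! ### Existence of lifts by induction on the support. -/

section Existence

variable {R : Type w} [CommRing R] {P : PartialField R} {𝔽 : Type*} [Field 𝔽] {f : R → 𝔽}
  {X : Type u} {Y : Type v} [DecidableEq X] [DecidableEq Y] {A : Matrix X Y 𝔽}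

/-- `A` is confined, and all matrices obtained by removing a nonzero row or column have lifts. -/
structure Critical (P : PartialField R) (f : R → 𝔽) (A : Matrix X Y 𝔽) : Prop where
  conf : CrossConfined (f '' P.fundamentalSet) A
  col : ∀ y, (∃ i, A i y ≠ 0) → HasLift P f (A.updateCol y 0)
  row : ∀ x, (∃ j, A x j ≠ 0) → HasLift P f (A.transpose.updateCol x 0)

theorem Critical.transpose (h : Critical P f A) : Critical P f A.transpose :=
  ⟨h.conf.transpose, h.row, by simpa using h.col⟩

theorem Critical.hasLift_of_three [Finite X] [Finite Y] (hf : P.IsLiftable f) (h : Critical P f A)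
    {z : Y} {a b c : X} (hab : a ≠ b) (hac : a ≠ c) (hbc : b ≠ c) (ha : A a z ≠ 0) (hb : A b z ≠ 0)
    (hc : A c z ≠ 0) : HasLift P f A := by
  have hn : Function.Injective ![a, b, c] := by
    intro i j
    fin_cases i <;> fin_cases j <;> simp [hab, hac, hbc, hab.symm, hac.symm, hbc.symm]
  rcases exists_columnsLinked (A := A) (z := z) hn (fun i => by fin_cases i <;> simpa) with
    ⟨x, y, hxy, hx, hy, hl⟩ | ⟨x, y, hxy, hx, hy, hl⟩
  · exact HasLift.glue hf hxy h.conf hl (h.col x hx) (h.col y hy)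
  · exact (HasLift.glue hf hxy h.conf.transpose hl (h.row x hx) (h.row y hy)).transpose

/-- A nonzero column of a critical matrix without a lift has exactly two nonzero entries. -/
theorem Critical.exists_two [Finite X] [Finite Y] (hf : P.IsLiftable f) (h : Critical P f A)
    (hA : ¬ HasLift P f A) {i : X} {y : Y} (hi : A i y ≠ 0) :
    ∃ k, k ≠ i ∧ A k y ≠ 0 ∧ ∀ a, a ≠ i → a ≠ k → A a y = 0 := by
  by_cases hk : ∃ k, k ≠ i ∧ A k y ≠ 0
  · obtain ⟨k, hki, hk⟩ := hk
    refine ⟨k, hki, hk, fun a hai hak => by_contra fun ha => hA ?_⟩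
    exact h.hasLift_of_three hf hki.symm hai.symm hak.symm hi hk ha
  · push Not at hk
    exact absurd (HasLift.of_col_le_one hf hk (h.col y ⟨i, hi⟩)) hA

/-- In a counterexample every nonzero row and column has exactly two nonzero entries. The walk `k`,
`y`, `i`, `x`, `l` in the support graph either closes up with `l = k`, giving a 2 × 2 summand, or
has `l ≠ k`; then a pivot on `(i, y)` makes column `x` nonzero in the three rows `i`, `k`, `l`. -/
theorem Critical.hasLift [Finite X] [Finite Y] (hf : P.IsLiftable f) (h : Critical P f A)
    (hp : ∀ x y, A x y ≠ 0 → Critical P f (pivot A x y)) : HasLift P f A := by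
  by_contra hA
  by_cases h0 : ∃ i y, A i y ≠ 0
  swap
  · push Not at h0
    refine hA ⟨0, fun n r c => ?_, fun _ => 1, fun _ => 1, fun _ => one_ne_zero,
      fun _ => one_ne_zero, fun i j => by simp [h0 i j, hf.map_zero]⟩
    obtain _ | n := n
    · simp
    · rw [Matrix.det_eq_zero_of_row_eq_zero 0 (fun j => rfl)]
      exact zero_mem_elems
  obtain ⟨i, y, hiy⟩ := h0
  have hA' : ¬ HasLift P f A.transpose := fun h => hA (by simpa using h.transpose)
  obtain ⟨k, hki, hky, hcy⟩ := h.exists_two hf hA hiy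
  obtain ⟨x, hxy, hix, hri⟩ := h.transpose.exists_two hf hA' (i := y) (y := i) hiy
  simp only [Matrix.transpose_apply] at hix hri
  obtain ⟨l, hli, hlx, hcx⟩ := h.exists_two hf hA hix
  by_cases hkx : A k x = 0
  · have hlk : l ≠ k := by rintro rfl; exact hlx hkx
    refine hA (HasLift.of_pivot hf hiy
      ((hp i y hiy).hasLift_of_three hf (z := x) hki.symm hli.symm hlk.symm ?_ ?_ ?_))
    · rw [pivot_apply_row _ _ hxy]
      simpa using ⟨hiy, hix⟩
    · rw [pivot_apply _ hki hxy, hkx]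
      simpa using ⟨⟨hky, hiy⟩, hix⟩
    · rwa [pivot_row_eq hli (hcy l hli hlk)]
  · have hlk : l = k := by
      by_contra hlk
      exact hkx (hcx k hki fun h => hlk h.symm)
    subst hlk
    obtain ⟨z, hzy, hlz, hrl⟩ := h.transpose.exists_two hf hA' (i := y) (y := l) hky
    simp only [Matrix.transpose_apply] at hlz hrl
    have hzx : z = x := by
      by_contra hzx
      exact hlx (hrl x hxy fun h => hzx h.symm)
    subst hzx
    exact hA (HasLift.of_block hf hxy hli.symm h.conf hix hiy hlx hky
      (fun j hjx hjy => ⟨hri j hjy hjx, hrl j hjy hjx⟩)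
      (fun a hai hak => ⟨hcx a hai hak, hcy a hai hak⟩) (h.col z ⟨i, hix⟩))

/-- The number of nonzero columns plus the number of nonzero rows. -/
noncomputable def supportSize (A : Matrix X Y 𝔽) : ℕ :=
  {j | ∃ i, A i j ≠ 0}.ncard + {i | ∃ j, A i j ≠ 0}.ncard

omit [DecidableEq X] [DecidableEq Y] in
theorem supportSize_transpose : supportSize A.transpose = supportSize A := add_comm _ _

omit [DecidableEq X] [DecidableEq Y] in
theorem supportSize_pivot_le [Finite X] [Finite Y] {x : X} {y : Y} (h : A x y ≠ 0) :
    supportSize (pivot A x y) ≤ supportSize A := by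
  refine add_le_add (Set.ncard_le_ncard ?_ (Set.toFinite _)) (Set.ncard_le_ncard ?_ (Set.toFinite _))
  · rintro j ⟨i, hi⟩
    by_contra hj
    simp only [Set.mem_ofPred_eq, not_exists, not_not] at hj
    have hjy : j ≠ y := by rintro rfl; exact h (hj x)
    refine hi ?_
    by_cases hix : i = x
    · rw [hix, pivot_apply_row _ _ hjy, hj, mul_zero]
    · rw [pivot_apply _ hix hjy, hj, hj]; simp
  · rintro i ⟨j, hj⟩
    by_contra hi
    simp only [Set.mem_ofPred_eq, not_exists, not_not] at hi
    have hix : i ≠ x := by rintro rfl; exact h (hi y)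
    exact hj (by rw [pivot_row_eq hix (hi y), hi])

omit [DecidableEq X] in
theorem supportSize_updateCol_lt [Finite X] [Finite Y] {y : Y} (h : ∃ i, A i y ≠ 0) :
    supportSize (A.updateCol y 0) < supportSize A := by
  refine add_lt_add_of_lt_of_le (Set.ncard_lt_ncard ?_ (Set.toFinite _))
    (Set.ncard_le_ncard ?_ (Set.toFinite _))
  · refine ⟨?_, fun hs => ?_⟩
    · rintro j ⟨i, hi⟩
      by_cases hj : j = y
      · subst hj; simp at hi
      · exact ⟨i, by rwa [Matrix.updateCol_ne hj] at hi⟩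
    · obtain ⟨i, hi⟩ := hs h
      simp at hi
  · rintro i ⟨j, hi⟩
    by_cases hj : j = y
    · subst hj; simp at hi
    · exact ⟨j, by rwa [Matrix.updateCol_ne hj] at hi⟩

theorem CrossConfined.hasLift [Finite X] [Finite Y] (hf : P.IsLiftable f)
    (hA : CrossConfined (f '' P.fundamentalSet) A) : HasLift P f A := by
  induction hn : supportSize A using Nat.strong_induction_on generalizing A with
  | _ n ih =>
    -- Stated for all `B` of support size at most `n`, since a pivot need not make the support
    -- smaller but never enlarges it.
    have crit : ∀ B : Matrix X Y 𝔽, CrossConfined (f '' P.fundamentalSet) B →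
        supportSize B ≤ n → Critical P f B := by
      intro B hB hBn
      refine ⟨hB, fun y hy => ih _ ((supportSize_updateCol_lt hy).trans_le hBn)
        (hB.updateCol_zero y) rfl, fun x hx => ?_⟩
      have h1 : supportSize (B.transpose.updateCol x 0).transpose < n := by
        rw [supportSize_transpose]
        exact (supportSize_updateCol_lt hx).trans_le (supportSize_transpose.trans_le hBn)
      simpa using (ih _ h1 (hB.transpose.updateCol_zero x).transpose rfl).transpose
    exact (crit A hA hn.le).hasLift hf fun x y hxy =>
      crit _ (hA.reach (Reach.refl.pivot x y hxy)) ((supportSize_pivot_le hxy).trans hn.le)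

end Existence

/-! ### From cross ratios defined by `Yields` to `CrossConfined`. -/

section Confined

variable {𝔽 : Type w} [Field 𝔽] {X : Type u} {Y : Type v} {A : Matrix X Y 𝔽}

theorem Yields.scaleRows {X' : Type u} {Y' : Type v} [Finite X'] {B : Matrix X' Y' 𝔽}
    (h : (ofField 𝔽).Yields A B) {r : X' → 𝔽} (hr : ∀ i, r i ≠ 0) :
    (ofField 𝔽).Yields A (Matrix.of fun i j => r i * B i j) := by
  classical
  have := Fintype.ofFinite X'
  have key : ∀ s : Finset X', (ofField 𝔽).Yields A
      (Matrix.of fun i j => if i ∈ s then r i * B i j else B i j) := by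
    intro s
    induction s using Finset.induction_on with
    | empty =>
      convert h using 1
      ext i j
      simp
    | insert x s hx ih =>
      convert ih.scaleRow x (Units.mk0 (r x) (hr x)) (Subgroup.mem_top _) using 1
      ext i j
      by_cases hi : i = x
      · subst hi; simp [PartialField.scaleRow, hx]
      · simp [PartialField.scaleRow, hi]
  simpa using key Finset.univ

theorem Yields.scaleCols {X' : Type u} {Y' : Type v} [Finite Y'] {B : Matrix X' Y' 𝔽}
    (h : (ofField 𝔽).Yields A B) {c : Y' → 𝔽} (hc : ∀ j, c j ≠ 0) :
    (ofField 𝔽).Yields A (Matrix.of fun i j => B i j * c j) := by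
  classical
  have := Fintype.ofFinite Y'
  have key : ∀ s : Finset Y', (ofField 𝔽).Yields A
      (Matrix.of fun i j => if j ∈ s then B i j * c j else B i j) := by
    intro s
    induction s using Finset.induction_on with
    | empty =>
      convert h using 1
      ext i j
      simp
    | insert y s hy ih =>
      convert ih.scaleCol y (Units.mk0 (c y) (hc y)) (Subgroup.mem_top _) using 1
      ext i j
      by_cases hj : j = y
      · subst hj; simp [PartialField.scaleCol, hy, mul_comm]
      · simp [PartialField.scaleCol, hj]
  simpa using key Finset.univ

theorem Yields.of_reach [Finite X] [Finite Y] {B : Matrix X Y 𝔽} (h : Reach A B) :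
    (ofField 𝔽).Yields A B := by
  induction h with
  | refl => exact .refl
  | scale _ r c hr hc ih => exact (ih.scaleRows hr).scaleCols hc
  | pivot _ x y hxy ih => exact ih.pivot x y hxy

theorem Yields.submatrix_rows {X' X'' : Type u} {Y' : Type v} [Finite X'] {B : Matrix X' Y' 𝔽}
    (h : (ofField 𝔽).Yields A B) {e : X'' → X'} (he : Function.Injective e) :
    (ofField 𝔽).Yields A (B.submatrix e id) := by
  induction hn : Nat.card X' using Nat.strong_induction_on generalizing X' with
  | _ n ih =>
    by_cases hs : Function.Surjective e
    · exact h.permute (Equiv.ofBijective e ⟨he, hs⟩) (Equiv.refl _)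
    · simp only [Function.Surjective, not_forall, not_exists] at hs
      obtain ⟨x, hx⟩ := hs
      refine ih _ ?_ (h.deleteRow x) (e := fun a => ⟨e a, hx a⟩)
        (fun a b hab => he (Subtype.mk.inj hab)) rfl
      rw [← hn]
      exact Finite.card_subtype_lt (x := x) (by simp)

theorem Yields.submatrix_cols {X' : Type u} {Y' Y'' : Type v} [Finite Y'] {B : Matrix X' Y' 𝔽}
    (h : (ofField 𝔽).Yields A B) {e : Y'' → Y'} (he : Function.Injective e) :
    (ofField 𝔽).Yields A (B.submatrix id e) := by
  induction hn : Nat.card Y' using Nat.strong_induction_on generalizing Y' with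
  | _ n ih =>
    by_cases hs : Function.Surjective e
    · exact h.permute (Equiv.refl _) (Equiv.ofBijective e ⟨he, hs⟩)
    · simp only [Function.Surjective, not_forall, not_exists] at hs
      obtain ⟨y, hy⟩ := hs
      refine ih _ ?_ (h.deleteCol y) (e := fun a => ⟨e a, hy a⟩)
        (fun a b hab => he (Subtype.mk.inj hab)) rfl
      rw [← hn]
      exact Finite.card_subtype_lt (x := y) (by simp)

theorem div_mem_crossRatios [Finite X] [Finite Y] {B : Matrix X Y 𝔽} (h : Reach A B) {i k : X}
    {j l : Y} (hik : i ≠ k) (hjl : j ≠ l) (h1 : B i j ≠ 0) (h2 : B k l ≠ 0) (h3 : B i l ≠ 0) :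
    -- The 2 × 2 submatrix is normalised by dividing the columns by their entries in row `i` and
    -- then scaling row `k`. It is indexed by `ULift` of `Fin 2` to stay in the universes of `X` and
    -- `Y`.
    (B i l * B k j) / (B i j * B k l) ∈ (ofField 𝔽).crossRatios A := by
  have hr : Function.Injective fun a : ULift.{u} (Fin 2) => ![i, k] a.down := by
    rintro ⟨a⟩ ⟨b⟩
    fin_cases a <;> fin_cases b <;> simp [hik, hik.symm]
  have hc : Function.Injective fun a : ULift.{v} (Fin 2) => ![j, l] a.down := by
    rintro ⟨a⟩ ⟨b⟩
    fin_cases a <;> fin_cases b <;> simp [hjl, hjl.symm]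
  have hY := (((Yields.of_reach h).submatrix_rows hr).submatrix_cols hc).scaleRows
    (r := fun a => ![1, B i l / B k l] a.down) (by
      rintro ⟨a⟩
      fin_cases a <;> simp [h2, h3])
  refine ⟨_, _, _, Equiv.ulift.symm, Equiv.ulift.symm, hY.scaleCols
    (c := fun a => ![(B i j)⁻¹, (B i l)⁻¹] a.down) (by
      rintro ⟨a⟩
      fin_cases a <;> simp [h1, h3]), ?_⟩
  ext a b
  fin_cases a <;> fin_cases b <;> simp [h1, h3] <;> field_simp

/-- Repeated rows or columns give the ratio `1`, which is in `F`; the value `0` is excluded because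
all four entries are nonzero. -/
theorem IsConfined.crossConfined [Finite X] [Finite Y] {F : Set 𝔽} (h1 : (1 : 𝔽) ∈ F)
    (hA : (ofField 𝔽).IsConfined F A) : CrossConfined F A := by
  intro B hB i k j l hij hkl hil hkj
  have hone : (B i l * B k j) / (B i j * B k l) = 1 → (B i l * B k j) / (B i j * B k l) ∈ F :=
    fun h => h ▸ h1
  by_cases hik : i = k
  · subst hik
    exact hone (by field_simp)
  by_cases hjl : j = l
  · subst hjl
    exact hone (by field_simp)
  rcases hA.2 (div_mem_crossRatios hB hik hjl hij hkl hil) with h | h | h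
  · exact h
  · exact absurd h (div_ne_zero (mul_ne_zero hil hkj) (mul_ne_zero hij hkl))
  · exact hone h

end Confined

/-! ### Extending a homomorphism by zero to the whole ring. -/

section Hom

variable {R : Type u} [CommRing R] {P : PartialField R} {𝔽 : Type v} [Field 𝔽]

open scoped Classical in
/-- The extension by zero of a homomorphism from `P` to a field. -/
noncomputable def Hom.extend (φ : Hom P (ofField 𝔽)) (r : R) : 𝔽 :=
  if h : r ∈ P.elems then φ.val ⟨r, h⟩ else 0

variable (φ : Hom P (ofField 𝔽))

theorem Hom.extend_of_mem {r : R} (h : r ∈ P.elems) : φ.extend r = φ.val ⟨r, h⟩ := dif_pos h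

theorem Hom.image_extend : φ.extend '' P.fundamentalSet = φ.val '' P.fundamentals := by
  ext a
  constructor
  · rintro ⟨p, hp, rfl⟩
    exact ⟨⟨p, hp.1⟩, hp.2, (φ.extend_of_mem hp.1).symm⟩
  · rintro ⟨p, hp, rfl⟩
    exact ⟨p, ⟨p.2, hp⟩, φ.extend_of_mem p.2⟩

theorem Hom.isLiftable_extend (hinj : Set.InjOn φ.val P.fundamentals)
    (hadd : ∀ p ∈ P.fundamentals, ∀ q ∈ P.fundamentals,
      φ.val p + φ.val q = 1 → (p : R) + (q : R) = 1)
    (hmul : ∀ p ∈ P.fundamentals, ∀ q ∈ P.fundamentals, ∀ r ∈ P.fundamentals,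
      φ.val p * φ.val q * φ.val r = 1 → (p : R) * (q : R) * (r : R) = 1)
    (htwo : (1 : 𝔽) = -1 → (1 : R) = -1) : P.IsLiftable φ.extend where
  map_one := by
    rw [φ.extend_of_mem P.elems.one_mem]
    exact congrArg Subtype.val φ.toMonoidHom.map_one
  map_mul p hp q hq := by
    rw [φ.extend_of_mem hp, φ.extend_of_mem hq, φ.extend_of_mem (P.elems.mul_mem hp hq)]
    exact congrArg Subtype.val (φ.toMonoidHom.map_mul ⟨p, hp⟩ ⟨q, hq⟩)
  map_add p hp q hq h := by
    rw [φ.extend_of_mem hp, φ.extend_of_mem hq, φ.extend_of_mem h]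
    exact (φ.map_add' ⟨p, hp⟩ ⟨q, hq⟩ h).symm
  injOn p hp q hq h := by
    rw [φ.extend_of_mem hp.1, φ.extend_of_mem hq.1] at h
    exact congrArg Subtype.val (hinj hp.2 hq.2 h)
  add_eq_one p hp q hq h := by
    rw [φ.extend_of_mem hp.1, φ.extend_of_mem hq.1] at h
    exact hadd _ hp.2 _ hq.2 h
  mul_eq_one p hp q hq r hr h := by
    rw [φ.extend_of_mem hp.1, φ.extend_of_mem hq.1, φ.extend_of_mem hr.1] at h
    exact hmul _ hp.2 _ hq.2 _ hr.2 h
  one_eq_neg_one := htwo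

end Hom

end PartialField

theorem mainTheorem5 {R : Type*} [CommRing R] (P : PartialField R)
    {𝔽 : Type*} [Field 𝔽] [Finite 𝔽]
    (φ : PartialField.Hom P (PartialField.ofField 𝔽))
    (hinj : Set.InjOn φ.val P.fundamentals)
    (hadd : ∀ p ∈ P.fundamentals, ∀ q ∈ P.fundamentals,
      φ.val p + φ.val q = 1 → (p : R) + (q : R) = 1)
    (hmul : ∀ p ∈ P.fundamentals, ∀ q ∈ P.fundamentals, ∀ r ∈ P.fundamentals,
      φ.val p * φ.val q * φ.val r = 1 → (p : R) * (q : R) * (r : R) = 1)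
    (htwo : (1 : 𝔽) = -1 → (1 : R) = -1)
    {X : Type*} {Y : Type*} [Finite X] [Finite Y] (A : Matrix X Y 𝔽)
    (hA : (PartialField.ofField 𝔽).IsConfined (φ.val '' P.fundamentals) A) :
    ∃ A' : Matrix X Y P.elems,
      P.IsPMatrix (A'.map (fun p => (p : R))) ∧
      (PartialField.ofField 𝔽).ScalingEquivalent (A'.map φ.val) A := by
  classical
  have hf := φ.isLiftable_extend hinj hadd hmul htwo
  rw [← φ.image_extend] at hA
  obtain ⟨M, hM, r, c, hr, hc, h⟩ := (hA.crossConfined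
    (hf.map_one ▸ Set.mem_image_of_mem _ PartialField.one_mem_fundamentalSet)).hasLift hf
  -- `HasLift` scales `A` to the image of the lift, whereas the goal scales the image to `A`; hence
  -- the inverses.
  refine ⟨Matrix.of fun i j => ⟨M i j, hM.apply_mem i j⟩, hM,
    fun i => ⟨(Units.mk0 (r i) (hr i))⁻¹, Subgroup.mem_top _⟩,
    fun j => ⟨(Units.mk0 (c j) (hc j))⁻¹, Subgroup.mem_top _⟩, fun i j => ?_⟩
  have e := h i j
  rw [φ.extend_of_mem (hM.apply_mem i j)] at e
  have := hr i
  have := hc j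
  simp only [Matrix.map_apply, Matrix.of_apply, e, Units.val_inv_eq_inv_val, Units.val_mk0]
  field_simp
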